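/- Let $(W,S)$ be a finite Coxeter group with length function $\ell$ and longest element $w_0$, let $\Gamma$ be a totally ordered abelian group (written additively), and let $L:W\to\Gamma$ be a weight function, i.e. $L(ww')=L(w)+L(w')$ whenever $\ell(ww')=\ell(w)+\ell(w')$, with $L(s)>0$ for all $s\in S$. Let $A=\mathbb Z[\Gamma]$ be the group algebra, with $\mathbb Z$-basis $(v^\gamma)_{\gamma\in\Gamma}$; let $\deg a$ be the largest $\gamma$ such that $v^\gamma$ occurs in $a\in A$ ($\deg 0=-\infty$), let $\bar{\ }$ be the involution $v^\gamma\mapsto v^{-\gamma}$ of $A$, and let $A_{<0}=\bigoplus_{\gamma<0}\mathbb Z v^\gamma$. Let $\mathcal H$ be the Hecke algebra: the associative $A$-algebra with $A$-basis $(T_w)_{w\in W}$ such that $T_wT_{w'}=T_{ww'}$ if $\ell(ww')=\ell(w)+\ell(w')$, and $T_s^2=1+(v^{L(s)}-v^{-L(s)})T_s$ for $s\in S$. The $T_w$ are invertible; put $\overline{\sum_w a_wT_w}=\sum_w\bar a_w T_{w^{-1}}^{-1}$. Let $(C_w)_{w\in W}$ be the Kazhdan–Lusztig basis: $C_w$ is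 the unique element of $\mathcal H$ with $\overline{C_w}=C_w$ and $C_w\in T_w+\bigoplus_{y\in W}A_{<0}T_y$. Let $\tau:\mathcal H\to A$ be the $A$-linear map with $\tau(T_w)=\delta_{1,w}$. Write $C_xC_y=\sum_z h_{x,y,z}C_z$ with $h_{x,y,z}\in A$, and set $\mathbf a(z)=\max_{x,y\in W}\deg h_{x,y,z}\in\Gamma$; let $\gamma_{x,y,z^{-1}}\in\mathbb Z$ be the coefficient of $v^{\mathbf a(z)}$ in $h_{x,y,z}$; let $\Delta(z)=-\deg\tau(C_z)$ and $\mathcal D=\{z\in W:\mathbf a(z)=\Delta(z)\}$. Let $\leqslant_{\mathcal L}$ (resp. $\leqslant_{\mathcal{LR}}$) be the reflexive and transitive closure of the relation "$C_x$ occurs with nonzero coefficient in $C_sC_y$ for some $s\in S$" (resp. "in $C_sC_y$ or in $C_yC_s$ for some $s\in S$") between $x$ and $y$; let $\sim_{\mathcal L}$ be the equivalence relation attached to $\leqslant_{\mathcal L}$, whose classes are the left cells. Assume that the following hold for $(W,S,L)$: - ($P_1$) $\mathbf a(z)\leqslant\Delta(z)$ for all $z\in W$. - ($P_2$) If $d\in\mathcal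 D$ and $x,y\in W$ satisfy $\gamma_{x,y,d}\neq0$, then $x=y^{-1}$. - ($P_4$) If $z'\leqslant_{\mathcal{LR}}z$, then $\mathbf a(z)\leqslant\mathbf a(z')$. - ($P_8$) If $\gamma_{x,y,z}\neq0$, then $x\sim_{\mathcal L}y^{-1}$, $y\sim_{\mathcal L}z^{-1}$ and $z\sim_{\mathcal L}x^{-1}$. - ($P_9$) If $z'\leqslant_{\mathcal L}z$ and $\mathbf a(z')=\mathbf a(z)$, then $z'\sim_{\mathcal L}z$. - ($P_{13}$) Every left cell contains a unique element $d\in\mathcal D$, and $\gamma_{y^{-1},y,d}\neq0$ for every $y$ in that left cell. Let $w\in W$ and let $n\geqslant0$ be an integer. Then $$\deg\tau(T_{w_0}^{-n}C_w)\leqslant-\mathbf a(w)+n\bigl(\mathbf a(w_0w)-\mathbf a(w)\bigr),$$ and equality holds if and only if $w_0^nw^{-1}\in\mathcal D$. -/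

import Mathlib

/-! ## Two facts on Coxeter groups -/

namespace CoxeterSystem

section

variable {B : Type*} {M : CoxeterMatrix B} {W : Type*} [Group W] (cs : CoxeterSystem M W)

open Classical in
/-- The signed permutation attached to a simple reflection `s`: it acts on `W × ℤ/2` by
`(t, ε) ↦ (s t s, ε + [t = s])`. -/
noncomputable def signPerm (i : B) : Equiv.Perm (W × ZMod 2) where
  toFun p := (cs.simple i * p.1 * cs.simple i, p.2 + if p.1 = cs.simple i then 1 else 0)
  invFun p := (cs.simple i * p.1 * cs.simple i, p.2 + if p.1 = cs.simple i then 1 else 0)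
  left_inv p := by
    have h2 : (1 : ZMod 2) + 1 = 0 := by decide
    have h : cs.simple i * p.1 * cs.simple i = cs.simple i ↔ p.1 = cs.simple i := by
      constructor
      · intro h
        have := congrArg (fun x => cs.simple i * x * cs.simple i) h
        simpa [mul_assoc] using this
      · intro h; simp [h]
    ext
    · simp [mul_assoc]
    · simp only [h]; split_ifs <;> simp [add_assoc, h2]
  right_inv p := by
    have h2 : (1 : ZMod 2) + 1 = 0 := by decide
    have h : cs.simple i * p.1 * cs.simple i = cs.simple i ↔ p.1 = cs.simple i := by
      constructor
      · intro h
        have := congrArg (fun x => cs.simple i * x * cs.simple i) h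
        simpa [mul_assoc] using this
      · intro h; simp [h]
    ext
    · simp [mul_assoc]
    · simp only [h]; split_ifs <;> simp [add_assoc, h2]

open Classical in
theorem signPerm_mul_pow (i j : B) (k : ℕ) (t : W) (e : ZMod 2) :
    ((cs.signPerm i * cs.signPerm j) ^ k) (t, e) =
      ((cs.simple i * cs.simple j) ^ k * t * ((cs.simple i * cs.simple j) ^ k)⁻¹,
        e + ∑ l ∈ Finset.range (2 * k),
          if t = ((cs.simple i * cs.simple j) ^ l)⁻¹ * cs.simple j then 1 else 0) := by
  induction k with
  | zero => simp
  | succ k ih =>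
    rw [pow_succ', Equiv.Perm.mul_apply, ih, Equiv.Perm.mul_apply,
      show 2 * (k + 1) = 2 * k + 1 + 1 by ring, Finset.sum_range_succ, Finset.sum_range_succ]
    set r := cs.simple i * cs.simple j with hr
    have hrinv : r⁻¹ = cs.simple j * cs.simple i := by simp [hr]
    have hsr : ∀ n : ℕ, cs.simple j * r ^ n = (r ^ n)⁻¹ * cs.simple j := by
      intro n
      induction n with
      | zero => simp
      | succ n ihn =>
        have h1 : cs.simple j * r = r⁻¹ * cs.simple j := by rw [hrinv, hr, mul_assoc]
        rw [pow_succ, ← mul_assoc, ihn, mul_assoc, h1, ← mul_assoc, ← mul_inv_rev, ← pow_succ',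
          ← pow_succ]
    have h1 : r ^ k * t * (r ^ k)⁻¹ = cs.simple j ↔ t = (r ^ (2 * k))⁻¹ * cs.simple j := by
      rw [mul_inv_eq_iff_eq_mul, hsr, two_mul, pow_add, mul_inv_rev, mul_assoc]
      exact ⟨fun h => by rw [← h]; simp, fun h => by rw [h]; simp⟩
    have h2 : cs.simple j * (r ^ k * t * (r ^ k)⁻¹) * cs.simple j = cs.simple i ↔
        t = (r ^ (2 * k + 1))⁻¹ * cs.simple j := by
      have e1 : cs.simple j * (r ^ k * t * (r ^ k)⁻¹) * cs.simple j = cs.simple i ↔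
          r ^ k * t * (r ^ k)⁻¹ = r⁻¹ * cs.simple j := by
        rw [hrinv]
        constructor
        · intro h; rw [← h]; simp [mul_assoc]
        · intro h; rw [h]; simp [mul_assoc]
      rw [e1, mul_inv_eq_iff_eq_mul, mul_assoc, hsr, pow_succ', two_mul, pow_add]
      constructor
      · intro h
        have := congrArg (fun x => (r ^ k)⁻¹ * x) h
        simp only [inv_mul_cancel_left] at this
        rw [this]
        have hc : Commute r (r ^ k) := (Commute.refl r).pow_right k
        simp only [mul_inv_rev, mul_assoc]
        rw [← mul_assoc r⁻¹, ← mul_inv_rev, hc.eq.symm, mul_inv_rev]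
        simp only [mul_assoc]
      · intro h
        rw [h]
        have hc : Commute r (r ^ k) := (Commute.refl r).pow_right k
        simp only [mul_inv_rev, mul_assoc, mul_inv_cancel_left]
        rw [← mul_assoc (r ^ k)⁻¹, ← mul_inv_rev, hc.eq, mul_inv_rev, mul_assoc]
    simp only [signPerm, Equiv.coe_fn_mk]
    ext
    · simp only [hr, pow_succ', mul_inv_rev, cs.inv_simple, mul_assoc]
    · simp only [h1, h2, add_assoc]

theorem signPerm_isLiftable : M.IsLiftable cs.signPerm := by
  classical
  intro i j
  ext1 ⟨t, e⟩
  rw [signPerm_mul_pow, cs.simple_mul_simple_pow, two_mul, Finset.sum_range_add]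
  have h2 : ∀ x : ZMod 2, x + x = 0 := by decide
  simp [pow_add, cs.simple_mul_simple_pow, h2]

theorem lift_signPerm_wordProd [DecidableEq W] (ω : List B) (t : W) (e : ZMod 2) :
    cs.lift ⟨cs.signPerm, cs.signPerm_isLiftable⟩ (cs.wordProd ω) (t, e) =
      (cs.wordProd ω * t * (cs.wordProd ω)⁻¹, e + (List.count t (cs.rightInvSeq ω) : ZMod 2)) := by
  induction ω with
  | nil => simp
  | cons i ω ih =>
    rw [wordProd_cons, map_mul, Equiv.Perm.mul_apply, ih, lift_apply_simple]
    have h : cs.wordProd ω * t * (cs.wordProd ω)⁻¹ = cs.simple i ↔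
        (cs.wordProd ω)⁻¹ * cs.simple i * cs.wordProd ω = t := by
      rw [mul_inv_eq_iff_eq_mul, mul_assoc, inv_mul_eq_iff_eq_mul, eq_comm]
    simp only [signPerm, Equiv.coe_fn_mk, rightInvSeq, List.count_cons, h]
    ext
    · simp [mul_assoc]
    · by_cases h' : (cs.wordProd ω)⁻¹ * cs.simple i * cs.wordProd ω = t <;> simp [h', add_assoc]

/-- Exchange: if `s w > w` and `w s' > w` but `s w s' < s w`, then `s w = w s'`. -/
theorem simple_mul_eq_mul_simple {w : W} {i j : B}
    (hi : cs.length w < cs.length (cs.simple i * w))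
    (hj : cs.length w < cs.length (w * cs.simple j))
    (hij : cs.length (cs.simple i * w * cs.simple j) < cs.length (cs.simple i * w)) :
    cs.simple i * w = w * cs.simple j := by
  classical
  obtain ⟨ω, hω, rfl⟩ := cs.exists_isReduced w
  obtain ⟨ω', hω', hu⟩ := cs.exists_isReduced (cs.simple i * cs.wordProd ω * cs.simple j)
  have h2 : ∀ x : ZMod 2, x + 1 ≠ x := by decide
  have hmem : cs.simple j ∈ cs.rightInvSeq (i :: ω) := by
    by_contra hn
    have e1 := cs.lift_signPerm_wordProd (i :: ω) (cs.simple j) 0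
    have e2 := cs.lift_signPerm_wordProd ω' (cs.simple j) 1
    rw [List.count_eq_zero_of_not_mem hn] at e1
    have hn' : cs.simple j ∉ cs.rightInvSeq ω' := by
      intro hm
      have := (cs.isRightInversion_of_mem_rightInvSeq hω' hm).2
      rw [← hu, mul_assoc _ _ (cs.simple j), cs.simple_mul_simple_self, mul_one] at this
      exact absurd this (by omega)
    rw [List.count_eq_zero_of_not_mem hn', ← hu, map_mul, Equiv.Perm.mul_apply,
      lift_apply_simple, ← wordProd_cons] at e2
    simp only [signPerm, Equiv.coe_fn_mk, if_true, cs.simple_mul_simple_self, one_mul] at e2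
    rw [show (1 : ZMod 2) + 1 = 0 by decide, e1] at e2
    have := congrArg Prod.snd e2
    simp at this
  simp only [rightInvSeq, List.mem_cons] at hmem
  rcases hmem with h | h
  · rw [h]; simp [mul_assoc]
  · have := (cs.isRightInversion_of_mem_rightInvSeq hω h).2
    omega

/-- Unless `s w = w s'`, multiplication by `s` on the left does not change whether
`s'` is a right descent. -/
theorem length_simple_mul_mul_simple_lt_iff {w : W} {i j : B}
    (h : cs.simple i * w ≠ w * cs.simple j) :
    cs.length (cs.simple i * w * cs.simple j) < cs.length (cs.simple i * w) ↔
      cs.length (w * cs.simple j) < cs.length w := by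
  have X1 := @simple_mul_eq_mul_simple B M W _ cs w i j
  have X2 := @simple_mul_eq_mul_simple B M W _ cs (cs.simple i * w) i j
  have X3 := @simple_mul_eq_mul_simple B M W _ cs (w * cs.simple j) i j
  have X4 := @simple_mul_eq_mul_simple B M W _ cs (cs.simple i * w * cs.simple j) i j
  have n2 : w ≠ cs.simple i * w * cs.simple j := fun e =>
    h (by nth_rewrite 1 [e]; simp [mul_assoc])
  have n3 : cs.simple i * (w * cs.simple j) ≠ w := fun e => n2 (by rw [mul_assoc, e])
  have n4 : w * cs.simple j ≠ cs.simple i * w := fun e => h e.symm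
  simp only [mul_assoc, cs.simple_mul_simple_self, mul_one, cs.simple_mul_simple_cancel_left]
    at X1 X2 X3 X4 n2 h n3 n4 ⊢
  have l1 := cs.length_simple_mul w i
  have l2 := cs.length_mul_simple w j
  have l3 := cs.length_mul_simple (cs.simple i * w) j
  have l4 := cs.length_simple_mul (w * cs.simple j) i
  simp only [mul_assoc] at l3
  have Y1 : ¬ (_ ∧ _ ∧ _) := fun c => h (X1 c.1 c.2.1 c.2.2)
  have Y2 : ¬ (_ ∧ _ ∧ _) := fun c => n2 (X2 c.1 c.2.1 c.2.2)
  have Y3 : ¬ (_ ∧ _ ∧ _) := fun c => n3 (X3 c.1 c.2.1 c.2.2)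
  have Y4 : ¬ (_ ∧ _ ∧ _) := fun c => n4 (X4 c.1 c.2.1 c.2.2)
  clear X1 X2 X3 X4

  rcases l1 with l1 | l1 <;> rcases l2 with l2 | l2 <;> rcases l3 with l3 | l3 <;>
    rcases l4 with l4 | l4 <;> omega

end

end CoxeterSystem
/-! ## The ring `A`: the group algebra of a totally ordered abelian group -/

namespace Hecke

section CoefficientRing

set_option linter.unusedSectionVars false

variable {Γ : Type*} [AddCommGroup Γ] [LinearOrder Γ]

/-- The basis element `v ^ γ` of the group algebra `A = ℤ[Γ]`. -/
noncomputable def v (γ : Γ) : AddMonoidAlgebra ℤ Γ := AddMonoidAlgebra.single γ 1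

/-- The degree of an element of `A`: the largest `γ` such that the coefficient of `v ^ γ` is
nonzero, with `deg 0 = -∞`. -/
noncomputable def deg (a : AddMonoidAlgebra ℤ Γ) : WithBot Γ := a.coeff.support.max

/-- The involution `v ^ γ ↦ v ^ (-γ)` of `A`. -/
noncomputable def barA : AddMonoidAlgebra ℤ Γ →+* AddMonoidAlgebra ℤ Γ :=
  AddMonoidAlgebra.mapDomainRingHom ℤ (-AddMonoidHom.id Γ : Γ →+ Γ)

/-- The subgroup `A_{< 0}` spanned by the `v ^ γ` with `γ < 0`. -/
def negA (Γ : Type*) [AddCommGroup Γ] [LinearOrder Γ] : AddSubgroup (AddMonoidAlgebra ℤ Γ) where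
  carrier := {a | ∀ γ, a.coeff γ ≠ 0 → γ < 0}
  zero_mem' := by simp
  add_mem' {a b} ha hb γ h := by
    by_cases h' : a.coeff γ = 0
    · exact hb γ fun h'' => h (by simp [h', h''])
    · exact ha γ h'
  neg_mem' {a} ha γ h := ha γ (by simpa using h)

theorem mem_negA {a : AddMonoidAlgebra ℤ Γ} : a ∈ negA Γ ↔ ∀ γ, a.coeff γ ≠ 0 → γ < 0 := Iff.rfl

theorem barA_single (γ : Γ) (n : ℤ) :
    barA (AddMonoidAlgebra.single γ n) = AddMonoidAlgebra.single (-γ) n := by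
  simp [barA]

theorem barA_v (γ : Γ) : barA (v γ) = v (-γ) := barA_single γ 1

theorem v_mul_v (γ δ : Γ) : v γ * v δ = v (γ + δ) := by
  simp [v, AddMonoidAlgebra.single_mul_single]

theorem barA_coeff (a : AddMonoidAlgebra ℤ Γ) (γ : Γ) : (barA a).coeff γ = a.coeff (-γ) := by
  induction a using AddMonoidAlgebra.induction_linear with
  | zero => simp
  | add f g hf hg => simp [hf, hg]
  | single δ n =>
    rw [barA_single]
    simp [AddMonoidAlgebra.coeff_single, Finsupp.single_apply, neg_eq_iff_eq_neg]

theorem barA_barA (a : AddMonoidAlgebra ℤ Γ) : barA (barA a) = a := by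
  ext γ; simp [barA_coeff]

theorem eq_zero_of_barA_eq [IsOrderedAddMonoid Γ] {a : AddMonoidAlgebra ℤ Γ} (h : barA a = a)
    (ha : a ∈ negA Γ) : a = 0 := by
  ext γ
  by_contra hγ
  have h1 := ha γ hγ
  have h2 := ha (-γ) (by rw [← barA_coeff, h]; exact hγ)
  exact absurd (neg_lt_zero.1 h2) h1.asymm

theorem v_neg_mem_negA [IsOrderedAddMonoid Γ] {γ : Γ} (h : 0 < γ) : v (-γ) ∈ negA Γ := by
  intro δ hδ
  simp only [v, AddMonoidAlgebra.coeff_single, Finsupp.single_apply] at hδ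
  split_ifs at hδ with h'
  · rw [← h']; exact neg_lt_zero.2 h
  · simp at hδ

theorem exists_bar_invariant [IsOrderedAddMonoid Γ] (a : AddMonoidAlgebra ℤ Γ) :
    ∃ b, barA b = b ∧ a - b ∈ negA Γ := by
  have hs : ∀ (γ : Γ) (n : ℤ), γ < 0 → AddMonoidAlgebra.single γ n ∈ negA Γ := by
    intro γ n h δ hδ
    simp only [AddMonoidAlgebra.coeff_single, Finsupp.single_apply] at hδ
    split_ifs at hδ with h'
    · rwa [← h']
    · simp at hδ
  induction a using AddMonoidAlgebra.induction_linear with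
  | zero => exact ⟨0, by simp, by simp⟩
  | add f g hf hg =>
    obtain ⟨b, hb, hb'⟩ := hf
    obtain ⟨c, hc, hc'⟩ := hg
    exact ⟨b + c, by simp [hb, hc], by rw [add_sub_add_comm]; exact add_mem hb' hc'⟩
  | single γ n =>
    rcases lt_trichotomy γ 0 with h | h | h
    · exact ⟨0, by simp, by simpa using hs γ n h⟩
    · exact ⟨AddMonoidAlgebra.single γ n, by rw [barA_single, h, neg_zero], by simp⟩
    · refine ⟨AddMonoidAlgebra.single γ n + AddMonoidAlgebra.single (-γ) n, ?_, ?_⟩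
      · rw [map_add, barA_single, barA_single, neg_neg, add_comm]
      · rw [sub_add_cancel_left]
        exact neg_mem (hs _ n (neg_lt_zero.2 h))

end CoefficientRing

/-! ## The Hecke algebra -/

/-- A weight function `L : W → Γ` on a Coxeter group, positive on the simple reflections. -/
structure WeightFunction {B : Type*} {M : CoxeterMatrix B} {W : Type*} [Group W]
    (cs : CoxeterSystem M W) (Γ : Type*) [AddCommGroup Γ] [LinearOrder Γ] where
  /-- the underlying function -/
  toFun : W → Γ
  map_mul : ∀ w w' : W, cs.length (w * w') = cs.length w + cs.length w' →
    toFun (w * w') = toFun w + toFun w'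
  pos : ∀ i : B, 0 < toFun (cs.simple i)

section

set_option linter.unusedSectionVars false

variable {B : Type*} {M : CoxeterMatrix B} {W : Type*} [Group W] {cs : CoxeterSystem M W}
  {Γ : Type*} [AddCommGroup Γ] [LinearOrder Γ] (L : WeightFunction cs Γ)

/-- The element `v ^ L(s) - v ^ (-L(s))` of `A`, for a simple reflection `s`. -/
noncomputable def q (i : B) : AddMonoidAlgebra ℤ Γ :=
  v (L.toFun (cs.simple i)) - v (-L.toFun (cs.simple i))

/-- Two simple reflections `s, s'` such that `s w = w s'` have the same weight. -/
theorem q_eq_of_simple_mul_eq {w : W} {i j : B} (h : cs.simple i * w = w * cs.simple j) :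
    q L i = q L j := by
  have key : L.toFun (cs.simple i) = L.toFun (cs.simple j) := by
    rcases cs.length_simple_mul w i with h1 | h1
    · have e1 := L.map_mul (cs.simple i) w (by rw [h1, cs.length_simple, add_comm])
      have e2 := L.map_mul w (cs.simple j) (by rw [← h, h1, cs.length_simple])
      rw [h, e2, add_comm] at e1
      exact (add_right_cancel e1).symm
    · have e1 := L.map_mul (cs.simple i) (cs.simple i * w)
        (by rw [cs.simple_mul_simple_cancel_left, cs.length_simple, add_comm, h1])
      have e2 := L.map_mul (w * cs.simple j) (cs.simple j)
        (by rw [cs.simple_mul_simple_cancel_right, cs.length_simple, ← h, h1])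
      rw [cs.simple_mul_simple_cancel_left] at e1
      rw [cs.simple_mul_simple_cancel_right, ← h, add_comm] at e2
      exact add_right_cancel (e1.symm.trans e2)
  rw [q, q, key]

open Classical in
/-- Left multiplication by `T_s` on the free `A`-module with basis `W`:
`w ↦ s w` if `s w > w`, and `w ↦ s w + (v ^ L(s) - v ^ (-L(s))) w` if `s w < w`. -/
noncomputable def leftOp (i : B) : Module.End (AddMonoidAlgebra ℤ Γ) (W →₀ AddMonoidAlgebra ℤ Γ) :=
  Finsupp.linearCombination (AddMonoidAlgebra ℤ Γ) fun w =>
    Finsupp.single (cs.simple i * w) 1 + if cs.IsLeftDescent w i then Finsupp.single w (q L i) else 0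

open Classical in
/-- Right multiplication by `T_s` on the free `A`-module with basis `W`. -/
noncomputable def rightOp (i : B) : Module.End (AddMonoidAlgebra ℤ Γ) (W →₀ AddMonoidAlgebra ℤ Γ) :=
  Finsupp.linearCombination (AddMonoidAlgebra ℤ Γ) fun w =>
    Finsupp.single (w * cs.simple i) 1 + if cs.IsRightDescent w i then Finsupp.single w (q L i) else 0

open Classical in
theorem leftOp_single (i : B) (w : W) : leftOp L i (Finsupp.single w 1) =
    Finsupp.single (cs.simple i * w) 1 +
      (if cs.IsLeftDescent w i then q L i else 0) • Finsupp.single w 1 := by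
  rw [leftOp, Finsupp.linearCombination_single, one_smul]
  split_ifs <;> simp

open Classical in
theorem rightOp_single (i : B) (w : W) : rightOp L i (Finsupp.single w 1) =
    Finsupp.single (w * cs.simple i) 1 +
      (if cs.IsRightDescent w i then q L i else 0) • Finsupp.single w 1 := by
  rw [rightOp, Finsupp.linearCombination_single, one_smul]
  split_ifs <;> simp

theorem leftOp_single_of_lt {i : B} {w : W} (h : ¬ cs.IsLeftDescent w i) :
    leftOp L i (Finsupp.single w 1) = Finsupp.single (cs.simple i * w) 1 := by
  simp [leftOp_single, h]

theorem end_ext {f g : Module.End (AddMonoidAlgebra ℤ Γ) (W →₀ AddMonoidAlgebra ℤ Γ)}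
    (h : ∀ w, f (Finsupp.single w 1) = g (Finsupp.single w 1)) : f = g :=
  Finsupp.lhom_ext' fun w => LinearMap.ext_ring (by simpa using h w)

theorem leftOp_mul_rightOp (i j : B) : leftOp L i * rightOp L j = rightOp L j * leftOp L i := by
  classical
  apply end_ext
  intro w
  simp only [Module.End.mul_apply, leftOp_single, rightOp_single, map_add, map_smul]
  by_cases h : cs.simple i * w = w * cs.simple j
  · have hq := q_eq_of_simple_mul_eq L h
    have e1 : cs.IsLeftDescent (w * cs.simple j) i ↔ cs.IsRightDescent (cs.simple i * w) j := by
      rw [← h, CoxeterSystem.IsLeftDescent, CoxeterSystem.IsRightDescent, h,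
        cs.simple_mul_simple_cancel_right, ← h, cs.simple_mul_simple_cancel_left]
    have e2 : cs.IsLeftDescent w i ↔ cs.IsRightDescent w j := by
      rw [CoxeterSystem.IsLeftDescent, CoxeterSystem.IsRightDescent, h]
    rw [← mul_assoc, hq]
    simp only [e1, e2, h]
  · have e1 : cs.IsRightDescent (cs.simple i * w) j ↔ cs.IsRightDescent w j :=
      cs.length_simple_mul_mul_simple_lt_iff h
    have e2 : cs.IsLeftDescent (w * cs.simple j) i ↔ cs.IsLeftDescent w i := by
      have h' : cs.simple j * w⁻¹ ≠ w⁻¹ * cs.simple i := by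
        intro e
        apply h
        have := congrArg (fun x => x⁻¹) e
        simpa using this.symm
      have := cs.length_simple_mul_mul_simple_lt_iff h'
      rw [← cs.length_inv, ← cs.length_inv (cs.simple j * w⁻¹), ← cs.length_inv (w⁻¹ * _),
        ← cs.length_inv w⁻¹] at this
      simpa [CoxeterSystem.IsLeftDescent, mul_assoc] using this
    simp only [e1, e2, mul_assoc, smul_add, smul_smul]
    rw [mul_comm (ite _ _ _) (ite _ _ _)]
    abel

theorem leftOp_mul_self (i : B) : leftOp L i * leftOp L i = 1 + q L i • leftOp L i := by
  classical
  apply end_ext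
  intro w
  simp only [Module.End.mul_apply, leftOp_single, map_add, map_smul, LinearMap.add_apply,
    LinearMap.smul_apply, Module.End.one_apply, cs.simple_mul_simple_cancel_left]
  by_cases h : cs.IsLeftDescent w i
  · have h' : ¬ cs.IsLeftDescent (cs.simple i * w) i := by
      rwa [← cs.isLeftDescent_iff_not_isLeftDescent_mul]
    simp [h, h']
  · have h' : cs.IsLeftDescent (cs.simple i * w) i := by
      by_contra h''
      exact h (cs.isLeftDescent_iff_not_isLeftDescent_mul.2 h'')
    simp [h, h']

/-- The algebra of operators on the free `A`-module with basis `W` generated by the left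
multiplications by the `T_s`. -/
noncomputable def heckeSubalgebra : Subalgebra (AddMonoidAlgebra ℤ Γ)
    (Module.End (AddMonoidAlgebra ℤ Γ) (W →₀ AddMonoidAlgebra ℤ Γ)) :=
  Algebra.adjoin (AddMonoidAlgebra ℤ Γ) (Set.range (leftOp L))

/-- The Hecke algebra `ℋ(W, S, L)`, constructed as an algebra of operators. It is the
`A`-algebra with basis `T` (see `Hecke.T`) and with the multiplication rules `Hecke.T_mul_T` and
`Hecke.T_simple_mul_self`. -/
def HeckeAlgebra : Type _ := heckeSubalgebra L

/-- The ring structure of the Hecke algebra (composition of operators). -/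
noncomputable def heckeRing : Ring (HeckeAlgebra L) :=
  Algebra.semiringToRing (A := heckeSubalgebra L) (AddMonoidAlgebra ℤ Γ)

noncomputable instance instRingHeckeAlgebra : Ring (HeckeAlgebra L) := heckeRing L

/-- The `A`-algebra structure of the Hecke algebra. -/
noncomputable def heckeAlgebraStr : Algebra (AddMonoidAlgebra ℤ Γ) (HeckeAlgebra L) :=
  inferInstanceAs (Algebra (AddMonoidAlgebra ℤ Γ) (heckeSubalgebra L))

noncomputable instance instAlgebraHeckeAlgebra :
    Algebra (AddMonoidAlgebra ℤ Γ) (HeckeAlgebra L) := heckeAlgebraStr L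

/-- The inclusion of the Hecke algebra into the algebra of all operators. -/
noncomputable def toEnd : HeckeAlgebra L →ₐ[AddMonoidAlgebra ℤ Γ]
    Module.End (AddMonoidAlgebra ℤ Γ) (W →₀ AddMonoidAlgebra ℤ Γ) :=
  (heckeSubalgebra L).val

theorem toEnd_injective : Function.Injective (toEnd L) := Subtype.val_injective

/-- Evaluation of an operator at the basis vector `1 ∈ W`. -/
noncomputable def ev : HeckeAlgebra L →ₗ[AddMonoidAlgebra ℤ Γ] (W →₀ AddMonoidAlgebra ℤ Γ) where
  toFun h := toEnd L h (Finsupp.single 1 1)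
  map_add' _ _ := by simp
  map_smul' _ _ := by simp

/-- The generator `T_s`. -/
noncomputable def gen (i : B) : HeckeAlgebra L :=
  (⟨leftOp L i, Algebra.subset_adjoin ⟨i, rfl⟩⟩ : heckeSubalgebra L)

theorem toEnd_gen (i : B) : toEnd L (gen L i) = leftOp L i := rfl

theorem commute_rightOp (h : HeckeAlgebra L) (j : B) :
    rightOp L j * toEnd L h = toEnd L h * rightOp L j := by
  obtain ⟨h, hh⟩ := h
  change rightOp L j * h = h * rightOp L j
  induction hh using Algebra.adjoin_induction with
  | mem x hx =>
    obtain ⟨i, rfl⟩ := hx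
    exact (leftOp_mul_rightOp L i j).symm
  | algebraMap r => exact (Algebra.commutes r _).symm
  | add x y _ _ hx hy => rw [mul_add, add_mul, hx, hy]
  | mul x y _ _ hx hy => rw [← mul_assoc, hx, mul_assoc, hy, mul_assoc]

theorem ev_injective : Function.Injective (ev L) := by
  rw [injective_iff_map_eq_zero]
  intro h hh
  apply toEnd_injective L
  apply end_ext
  intro w
  rw [map_zero, LinearMap.zero_apply]
  induction hn : cs.length w using Nat.strong_induction_on generalizing w with
  | _ n ih =>
    by_cases hw : w = 1
    · rw [hw]; exact hh
    · obtain ⟨j, hj⟩ := cs.exists_rightDescent_of_ne_one hw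
      have e : (Finsupp.single w 1 : W →₀ AddMonoidAlgebra ℤ Γ) =
          rightOp L j (Finsupp.single (w * cs.simple j) 1) := by
        rw [rightOp_single, if_neg (cs.isRightDescent_iff_not_isRightDescent_mul.1 hj)]
        simp
      rw [e, ← Module.End.mul_apply, ← commute_rightOp, Module.End.mul_apply,
        ih _ (by rw [← hn]; exact hj) _ rfl, map_zero]

/-- If a word `ω` satisfies `ℓ(ω w) = |ω| + ℓ(w)`, the corresponding product of generators
maps the basis vector `w` to `ω w`. -/
theorem prod_gen_single (ω : List B) (w : W)
    (h : cs.length (cs.wordProd ω * w) = ω.length + cs.length w) :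
    toEnd L (ω.map (gen L)).prod (Finsupp.single w 1) = Finsupp.single (cs.wordProd ω * w) 1 := by
  induction ω with
  | nil => simp
  | cons i ω ih =>
    rw [cs.wordProd_cons, mul_assoc, List.length_cons] at h
    have h1 := cs.length_mul_le (cs.wordProd ω) w
    have h2 := cs.length_wordProd_le ω
    have h3 := cs.length_mul_le (cs.simple i) (cs.wordProd ω * w)
    rw [cs.length_simple] at h3
    have h4 : cs.length (cs.wordProd ω * w) = ω.length + cs.length w := by omega
    have h5 : ¬ cs.IsLeftDescent (cs.wordProd ω * w) i := by
      rw [CoxeterSystem.IsLeftDescent]; omega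
    rw [List.map_cons, List.prod_cons, cs.wordProd_cons, mul_assoc, ← leftOp_single_of_lt L h5,
      ← ih h4, map_mul, toEnd_gen, Module.End.mul_apply]

theorem ev_surjective : Function.Surjective (ev L) := by
  rw [← LinearMap.range_eq_top, ← top_le_iff]
  intro f _
  induction f using Finsupp.induction_linear with
  | zero => exact zero_mem _
  | add f g hf hg => exact add_mem (hf trivial) (hg trivial)
  | single w a =>
    obtain ⟨ω, hω, rfl⟩ := cs.exists_isReduced w
    refine ⟨a • (ω.map (gen L)).prod, ?_⟩
    rw [map_smul]
    have : ev L (ω.map (gen L)).prod = Finsupp.single (cs.wordProd ω * 1) 1 :=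
      prod_gen_single L ω 1 (by rw [mul_one, cs.length_one, add_zero]; exact hω)
    rw [this]
    simp

/-- The standard basis `(T_w)_{w ∈ W}` of the Hecke algebra. -/
noncomputable def T : Module.Basis W (AddMonoidAlgebra ℤ Γ) (HeckeAlgebra L) :=
  Module.Basis.ofRepr (LinearEquiv.ofBijective (ev L) ⟨ev_injective L, ev_surjective L⟩)

theorem ev_T (w : W) : ev L (T L w) = Finsupp.single w 1 :=
  (LinearEquiv.ofBijective (ev L) ⟨ev_injective L, ev_surjective L⟩).apply_symm_apply _

theorem T_wordProd {ω : List B} (h : cs.IsReduced ω) :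
    T L (cs.wordProd ω) = (ω.map (gen L)).prod := by
  apply ev_injective
  rw [ev_T]
  have := prod_gen_single L ω 1 (by rw [mul_one, cs.length_one, add_zero]; exact h)
  rw [mul_one] at this
  exact this.symm

theorem T_one : T L 1 = 1 := by
  simpa using T_wordProd L (ω := []) (by simp [CoxeterSystem.IsReduced])

theorem T_simple (i : B) : T L (cs.simple i) = gen L i := by
  simpa using T_wordProd L (ω := [i]) (by simp [CoxeterSystem.IsReduced])

/-- `T_w T_w' = T_{w w'}` if `ℓ(w w') = ℓ(w) + ℓ(w')`. -/
theorem T_mul_T {w w' : W} (h : cs.length (w * w') = cs.length w + cs.length w') :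
    T L w * T L w' = T L (w * w') := by
  obtain ⟨ω, hω, rfl⟩ := cs.exists_isReduced w
  obtain ⟨ω', hω', rfl⟩ := cs.exists_isReduced w'
  rw [← cs.wordProd_append, T_wordProd L hω, T_wordProd L hω', T_wordProd L, List.map_append,
    List.prod_append]
  rw [CoxeterSystem.IsReduced, cs.wordProd_append, h, hω, hω', List.length_append]

/-- `T_s ^ 2 = 1 + (v ^ L(s) - v ^ (-L(s))) T_s`. -/
theorem T_simple_mul_self (i : B) : T L (cs.simple i) * T L (cs.simple i) =
    1 + (v (L.toFun (cs.simple i)) - v (-L.toFun (cs.simple i))) • T L (cs.simple i) := by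
  rw [T_simple]
  apply toEnd_injective L
  rw [map_mul, map_add, map_smul, map_one, toEnd_gen]
  exact leftOp_mul_self L i

theorem T_simple_mul_of_lt {i : B} {w : W} (h : ¬ cs.IsLeftDescent w i) :
    T L (cs.simple i) * T L w = T L (cs.simple i * w) :=
  T_mul_T L (by rw [cs.length_simple, add_comm]; exact cs.not_isLeftDescent_iff.1 h)

theorem T_simple_mul_of_gt {i : B} {w : W} (h : cs.IsLeftDescent w i) :
    T L (cs.simple i) * T L w = T L (cs.simple i * w) + q L i • T L w := by
  have h' := cs.isLeftDescent_iff_not_isLeftDescent_mul.1 h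
  have e := T_simple_mul_of_lt L h'
  rw [cs.simple_mul_simple_cancel_left] at e
  rw [← e, ← mul_assoc, T_simple_mul_self, add_mul, one_mul, smul_mul_assoc, q]

/-- The elements `T_w` are invertible. -/
theorem isUnit_T (w : W) : IsUnit (T L w) := by
  have hs : ∀ i, IsUnit (T L (cs.simple i)) := by
    intro i
    refine isUnit_iff_exists.2 ⟨T L (cs.simple i) - algebraMap (AddMonoidAlgebra ℤ Γ) (HeckeAlgebra L) (q L i), ?_, ?_⟩
    · rw [mul_sub, T_simple_mul_self, ← Algebra.commutes, ← Algebra.smul_def, q,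
        add_sub_cancel_right]
    · rw [sub_mul, T_simple_mul_self, ← Algebra.smul_def, q, add_sub_cancel_right]
  obtain ⟨ω, hω, rfl⟩ := cs.exists_isReduced w
  rw [T_wordProd L hω]
  refine List.prod_isUnit ?_
  intro x hx
  obtain ⟨i, _, rfl⟩ := List.mem_map.1 hx
  rw [← T_simple]
  exact hs i

/-- `T_w` as an element of the group of units of the Hecke algebra. -/
noncomputable def TUnit (w : W) : (HeckeAlgebra L)ˣ := (isUnit_T L w).unit

theorem val_TUnit (w : W) : (TUnit L w : HeckeAlgebra L) = T L w := rfl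

end

end Hecke
/-! ## The Kazhdan–Lusztig basis -/

namespace Hecke

section

variable {B : Type*} {M : CoxeterMatrix B} {W : Type*} [Group W] {cs : CoxeterSystem M W}
  {Γ : Type*} [AddCommGroup Γ] [LinearOrder Γ] (L : WeightFunction cs Γ)

/-- The bar involution `∑ a_w T_w ↦ ∑ (bar a_w) (T_{w⁻¹})⁻¹` of the Hecke algebra. -/
noncomputable def bar (h : HeckeAlgebra L) : HeckeAlgebra L :=
  ((T L).repr h).sum fun w a => barA a • (((TUnit L w⁻¹)⁻¹ : (HeckeAlgebra L)ˣ) : HeckeAlgebra L)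

theorem bar_add (x y : HeckeAlgebra L) : bar L (x + y) = bar L x + bar L y := by
  rw [bar, map_add, Finsupp.sum_add_index']
  · rfl
  · simp
  · intro w a b; rw [map_add, add_smul]

theorem bar_smul (a : AddMonoidAlgebra ℤ Γ) (x : HeckeAlgebra L) :
    bar L (a • x) = barA a • bar L x := by
  rw [bar, map_smul, Finsupp.sum_smul_index (by simp), bar, Finsupp.smul_sum]
  simp only [map_mul, mul_smul]

theorem bar_zero : bar L 0 = 0 := by simpa using bar_smul L 0 0

theorem bar_neg (x : HeckeAlgebra L) : bar L (-x) = -bar L x := by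
  rw [eq_neg_iff_add_eq_zero, ← bar_add, neg_add_cancel, bar_zero]

theorem bar_sub (x y : HeckeAlgebra L) : bar L (x - y) = bar L x - bar L y := by
  rw [sub_eq_add_neg, bar_add, bar_neg, sub_eq_add_neg]

theorem bar_T (w : W) :
    bar L (T L w) = (((TUnit L w⁻¹)⁻¹ : (HeckeAlgebra L)ˣ) : HeckeAlgebra L) := by
  rw [bar, Module.Basis.repr_self, Finsupp.sum_single_index] <;> simp

theorem bar_T_one : bar L (T L 1) = T L 1 := by
  have : TUnit L (1 : W) = 1 := Units.ext (by rw [val_TUnit, T_one]; rfl)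
  rw [bar_T, inv_one, this, T_one]
  simp

/-- The inverse of `T_s`. -/
theorem T_simple_mul_inv (i : B) :
    T L (cs.simple i) * (T L (cs.simple i) - q L i • 1) = 1 := by
  rw [mul_sub, T_simple_mul_self, mul_smul_comm, mul_one, q, add_sub_cancel_right]

theorem T_simple_inv_mul (i : B) :
    (T L (cs.simple i) - q L i • 1) * T L (cs.simple i) = 1 := by
  rw [sub_mul, T_simple_mul_self, smul_mul_assoc, one_mul, q, add_sub_cancel_right]

theorem bar_T_simple_mul_of_lt {i : B} {w : W} (h : ¬ cs.IsLeftDescent w i) :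
    bar L (T L (cs.simple i * w)) = (T L (cs.simple i) - q L i • 1) * bar L (T L w) := by
  have h' : cs.length (w⁻¹ * cs.simple i) = cs.length w⁻¹ + cs.length (cs.simple i) := by
    rw [cs.length_inv, cs.length_simple, ← cs.length_inv, mul_inv_rev, inv_inv, cs.inv_simple]
    exact cs.not_isLeftDescent_iff.1 h
  have e : TUnit L (w⁻¹ * cs.simple i) = TUnit L w⁻¹ * TUnit L (cs.simple i) :=
    Units.ext (T_mul_T L h').symm
  rw [bar_T, bar_T, mul_inv_rev, cs.inv_simple, e, mul_inv_rev, Units.val_mul]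
  congr 1
  exact Units.inv_eq_of_mul_eq_one_right (T_simple_mul_inv L i)

theorem barA_q (i : B) : barA (q L i) = -q L i := by
  rw [q, map_sub, barA_v, barA_v, neg_neg, neg_sub]

theorem bar_T_simple_mul (i : B) (h : HeckeAlgebra L) :
    bar L (T L (cs.simple i) * h) = (T L (cs.simple i) - q L i • 1) * bar L h := by
  have hh : h ∈ Submodule.span (AddMonoidAlgebra ℤ Γ) (Set.range (T L)) := by
    rw [(T L).span_eq]; trivial
  induction hh using Submodule.span_induction with
  | zero => rw [mul_zero, bar_zero, mul_zero]
  | mem x hx =>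
    obtain ⟨w, rfl⟩ := hx
    by_cases h : cs.IsLeftDescent w i
    · have h' := cs.isLeftDescent_iff_not_isLeftDescent_mul.1 h
      have e := bar_T_simple_mul_of_lt L h'
      have e2 : (T L (cs.simple i) - q L i • 1) * (T L (cs.simple i) - q L i • 1) =
          1 - q L i • (T L (cs.simple i) - q L i • 1) := by
        rw [mul_sub, T_simple_inv_mul, mul_smul_comm, mul_one]
      rw [cs.simple_mul_simple_cancel_left] at e
      rw [T_simple_mul_of_gt L h, bar_add, bar_smul, e, ← mul_assoc, e2, barA_q, sub_mul 1, one_mul,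
        neg_smul, smul_mul_assoc, ← sub_eq_add_neg]
    · rw [T_simple_mul_of_lt L h, bar_T_simple_mul_of_lt L h]
  | add x y _ _ hx hy => rw [mul_add, bar_add, bar_add, mul_add, hx, hy]
  | smul a x _ hx => rw [mul_smul_comm, bar_smul, bar_smul, mul_smul_comm, hx]

/-- The `A`-submodule of the Hecke algebra spanned by the `T_y` with `ℓ(y) < n`. -/
noncomputable def below (n : ℕ) : Submodule (AddMonoidAlgebra ℤ Γ) (HeckeAlgebra L) :=
  Submodule.span (AddMonoidAlgebra ℤ Γ) (T L '' {y | cs.length y < n})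

/-- The additive subgroup `⨁_{y ∈ W} A_{< 0} T_y` of the Hecke algebra. -/
def negH : AddSubgroup (HeckeAlgebra L) where
  carrier := {h | ∀ y, (T L).repr h y ∈ negA Γ}
  zero_mem' y := by simp
  add_mem' {a b} ha hb y := by simpa using add_mem (ha y) (hb y)
  neg_mem' {a} ha y := by
    have e : (T L).repr (-a) y = -(T L).repr a y := by
      rw [eq_neg_iff_add_eq_zero, ← Finsupp.add_apply, ← map_add, neg_add_cancel]; simp
    rw [e]
    exact neg_mem (ha y)

/-- The characterization of the Kazhdan–Lusztig basis element `C_w`: it is fixed by the bar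
involution and lies in `T_w + ⨁_{y ∈ W} A_{< 0} T_y`. -/
def IsKL (w : W) (c : HeckeAlgebra L) : Prop :=
  bar L c = c ∧ c - T L w ∈ negH L

theorem T_mem_below {y : W} {n : ℕ} (h : cs.length y < n) : T L y ∈ below L n :=
  Submodule.subset_span ⟨y, h, rfl⟩

theorem below_mono {m n : ℕ} (h : m ≤ n) : below L m ≤ below L n :=
  Submodule.span_mono (Set.image_mono fun _ hy => lt_of_lt_of_le hy h)

theorem repr_eq_zero_of_mem_below {x : HeckeAlgebra L} {n : ℕ} (hx : x ∈ below L n) {y : W}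
    (hy : n ≤ cs.length y) : (T L).repr x y = 0 := by
  by_contra h
  exact absurd ((T L).mem_span_image.1 hx (Finsupp.mem_support_iff.2 h)) (not_lt.2 hy)

theorem T_simple_mul_mem_below {x : HeckeAlgebra L} {n : ℕ} (hx : x ∈ below L n) (i : B) :
    T L (cs.simple i) * x ∈ below L (n + 1) := by
  induction hx using Submodule.span_induction with
  | mem x hx =>
    obtain ⟨y, hy, rfl⟩ := hx
    have hy : cs.length y < n := hy
    by_cases h : cs.IsLeftDescent y i
    · rw [T_simple_mul_of_gt L h]
      have h' : cs.length (cs.simple i * y) < cs.length y := h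
      exact add_mem (T_mem_below L (by omega))
        (Submodule.smul_mem _ _ (T_mem_below L (by omega)))
    · rw [T_simple_mul_of_lt L h]
      have h' := cs.not_isLeftDescent_iff.1 h
      exact T_mem_below L (by omega)
  | zero => rw [mul_zero]; exact zero_mem _
  | add x y _ _ hx hy => rw [mul_add]; exact add_mem hx hy
  | smul a x _ hx => rw [mul_smul_comm]; exact Submodule.smul_mem _ _ hx

theorem smul_T_mem_negH {a : AddMonoidAlgebra ℤ Γ} (ha : a ∈ negA Γ) (w : W) :
    a • T L w ∈ negH L := by
  classical
  intro y
  rw [map_smul, Module.Basis.repr_self, Finsupp.smul_single, Finsupp.single_apply]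
  split_ifs
  · simpa using ha
  · exact zero_mem _

theorem bar_T_sub_mem (w : W) : bar L (T L w) - T L w ∈ below L (cs.length w) := by
  induction hn : cs.length w using Nat.strong_induction_on generalizing w with
  | _ n ih =>
    by_cases hw : w = 1
    · rw [hw, bar_T_one, sub_self]; exact zero_mem _
    · obtain ⟨i, hi⟩ := cs.exists_leftDescent_of_ne_one hw
      have hi' := cs.isLeftDescent_iff_not_isLeftDescent_mul.1 hi
      have hl := cs.isLeftDescent_iff.1 hi
      have := ih _ (by rw [← hn]; exact hi) (cs.simple i * w) rfl
      have e1 := T_simple_mul_of_lt L hi'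
      have e2 := bar_T_simple_mul_of_lt L hi'
      rw [cs.simple_mul_simple_cancel_left] at e1 e2
      have e3 : bar L (T L w) - T L w =
          T L (cs.simple i) * (bar L (T L (cs.simple i * w)) - T L (cs.simple i * w)) -
            q L i • ((bar L (T L (cs.simple i * w)) - T L (cs.simple i * w)) +
              T L (cs.simple i * w)) := by
        rw [e2, mul_sub, e1, sub_mul, smul_mul_assoc, one_mul, sub_add_cancel]
        abel
      rw [e3]
      have hm := T_simple_mul_mem_below L this i
      rw [hl, hn] at hm
      refine sub_mem hm (Submodule.smul_mem _ _ (add_mem ?_ (T_mem_below L (by omega))))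
      exact below_mono L (by omega) this

theorem repr_bar {h : HeckeAlgebra L} {y : W} (hh : h ∈ below L (cs.length y + 1)) :
    (T L).repr (bar L h) y = barA ((T L).repr h y) := by
  classical
  induction hh using Submodule.span_induction with
  | mem x hx =>
    obtain ⟨z, hz, rfl⟩ := hx
    have hz : cs.length z < cs.length y + 1 := hz
    have e := repr_eq_zero_of_mem_below L (bar_T_sub_mem L z) (y := y) (by omega)
    have e' : bar L (T L z) = (bar L (T L z) - T L z) + T L z := by rw [sub_add_cancel]
    rw [e', map_add, Finsupp.add_apply, e, zero_add, Module.Basis.repr_self, Finsupp.single_apply]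
    split_ifs <;> simp
  | zero => simp [bar_zero]
  | add x y _ _ hx hy => simp [bar_add, hx, hy]
  | smul a x _ hx => simp [bar_smul, hx]

section

variable [IsOrderedAddMonoid Γ]

theorem eq_zero_of_bar_eq {h : HeckeAlgebra L} (hb : bar L h = h) (hn : h ∈ negH L) : h = 0 := by
  by_contra h0
  have hs : ((T L).repr h).support.Nonempty := by
    rw [Finsupp.support_nonempty_iff]
    intro e
    exact h0 ((T L).repr.map_eq_zero_iff.1 e)
  obtain ⟨y, hy, hmax⟩ := Finset.exists_max_image _ (fun w => cs.length w) hs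
  have hh : h ∈ below L (cs.length y + 1) :=
    (T L).mem_span_image.2 fun z hz => Nat.lt_succ_of_le (hmax z hz)
  have e := repr_bar L hh
  rw [hb] at e
  exact Finsupp.mem_support_iff.1 hy (eq_zero_of_barA_eq e.symm (hn y))

theorem exists_decomposition {n : ℕ} (hc : ∀ y, cs.length y < n →
      ∃ c, IsKL L y c ∧ c - T L y ∈ below L (cs.length y))
    {x : HeckeAlgebra L} (hx : x ∈ below L n) :
    ∃ g, bar L g = g ∧ g ∈ below L n ∧ x - g ∈ negH L := by
  induction n generalizing x with
  | zero =>
    have : x = 0 := by simpa [below] using hx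
    exact ⟨0, bar_zero L, zero_mem _, by rw [this, sub_zero]; exact zero_mem _⟩
  | succ n ih =>
    suffices H : ∀ a : AddMonoidAlgebra ℤ Γ,
        ∃ g, bar L g = g ∧ g ∈ below L (n + 1) ∧ a • x - g ∈ negH L by
      simpa using H 1
    induction hx using Submodule.span_induction with
    | mem x hx =>
      obtain ⟨y, hy, rfl⟩ := hx
      have hy : cs.length y < n + 1 := hy
      intro a
      obtain ⟨b, hb, hab⟩ := exists_bar_invariant a
      obtain ⟨c, ⟨hc1, hc2⟩, hc3⟩ := hc y hy
      have hz : b • (T L y - c) ∈ below L n := by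
        refine Submodule.smul_mem _ _ ?_
        rw [← neg_sub]
        exact neg_mem (below_mono L (by omega) hc3)
      obtain ⟨g, hg1, hg2, hg3⟩ := ih (fun z hz => hc z (by omega)) hz
      refine ⟨b • c + g, ?_, ?_, ?_⟩
      · rw [bar_add, bar_smul, hb, hc1, hg1]
      · refine add_mem (Submodule.smul_mem _ _ ?_) (below_mono L (by omega) hg2)
        have e : c = (c - T L y) + T L y := by rw [sub_add_cancel]
        rw [e]
        exact add_mem (below_mono L (by omega) hc3) (T_mem_below L hy)
      · have e : a • T L y - (b • c + g) = (a - b) • T L y + (b • (T L y - c) - g) := by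
          rw [sub_smul, smul_sub]; abel
        rw [e]
        exact add_mem (smul_T_mem_negH L hab y) hg3
    | zero =>
      intro a
      exact ⟨0, bar_zero L, zero_mem _, by simp⟩
    | add x y _ _ hx hy =>
      intro a
      obtain ⟨g, hg1, hg2, hg3⟩ := hx a
      obtain ⟨g', hg1', hg2', hg3'⟩ := hy a
      refine ⟨g + g', by rw [bar_add, hg1, hg1'], add_mem hg2 hg2', ?_⟩
      rw [smul_add, add_sub_add_comm]
      exact add_mem hg3 hg3'
    | smul b x _ hx =>
      intro a
      rw [smul_smul]
      exact hx (a * b)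

theorem exists_isKL (w : W) : ∃ c, IsKL L w c ∧ c - T L w ∈ below L (cs.length w) := by
  induction hn : cs.length w using Nat.strong_induction_on generalizing w with
  | _ n ih =>
    by_cases hw : w = 1
    · refine ⟨T L w, ⟨?_, ?_⟩, ?_⟩
      · rw [hw, bar_T_one]
      · rw [sub_self]; exact zero_mem _
      · rw [sub_self]; exact zero_mem _
    · obtain ⟨i, hi⟩ := cs.exists_leftDescent_of_ne_one hw
      have hi' := cs.isLeftDescent_iff_not_isLeftDescent_mul.1 hi
      have hl := cs.isLeftDescent_iff.1 hi
      obtain ⟨c, ⟨hc1, hc2⟩, hc3⟩ := ih _ (by rw [← hn]; exact hi) (cs.simple i * w) rfl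
      have e1 := T_simple_mul_of_lt L hi'
      rw [cs.simple_mul_simple_cancel_left] at e1
      set p := v (-L.toFun (cs.simple i)) with hp
      set h := T L (cs.simple i) * c + p • c with hh
      have hbar : bar L h = h := by
        rw [hh, bar_add, bar_smul, bar_T_simple_mul, hc1, hp, barA_v, neg_neg, q, sub_mul,
          smul_mul_assoc, one_mul, sub_smul]
        abel
      have hx : h - T L w ∈ below L n := by
        have e : h - T L w = T L (cs.simple i) * (c - T L (cs.simple i * w)) +
            p • ((c - T L (cs.simple i * w)) + T L (cs.simple i * w)) := by
          rw [hh, mul_sub, e1, sub_add_cancel]; abel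
        rw [e]
        have hm := T_simple_mul_mem_below L hc3 i
        rw [hl, hn] at hm
        refine add_mem hm (Submodule.smul_mem _ _ (add_mem ?_ (T_mem_below L (by omega))))
        exact below_mono L (by omega) hc3
      obtain ⟨g, hg1, hg2, hg3⟩ :=
        exists_decomposition L (fun y hy => ih _ hy y rfl) hx
      refine ⟨h - g, ⟨by rw [bar_sub, hbar, hg1], ?_⟩, ?_⟩
      · rwa [sub_right_comm]
      · rw [sub_right_comm]; exact sub_mem hx hg2

/-- Existence and uniqueness of the element `C_w`. -/
theorem existsUnique_isKL (w : W) : ∃! c, IsKL L w c := by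
  obtain ⟨c, hc, -⟩ := exists_isKL L w
  refine ⟨c, hc, fun c' hc' => ?_⟩
  refine sub_eq_zero.1 (eq_zero_of_bar_eq L (by rw [bar_sub, hc.1, hc'.1]) ?_)
  rw [← sub_sub_sub_cancel_right _ _ (T L w)]
  exact sub_mem hc'.2 hc.2

/-- The unique bar-invariant element of `T_w + ⨁_{y ∈ W} A_{< 0} T_y`. -/
noncomputable def KL (w : W) : HeckeAlgebra L := (existsUnique_isKL L w).choose

theorem isKL_KL (w : W) : IsKL L w (KL L w) := (existsUnique_isKL L w).choose_spec.1

theorem KL_sub_mem_below (w : W) : KL L w - T L w ∈ below L (cs.length w) := by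
  obtain ⟨c, hc, hc'⟩ := exists_isKL L w
  rwa [(existsUnique_isKL L w).unique (isKL_KL L w) hc]

theorem repr_KL {w y : W} (h : cs.length w ≤ cs.length y) :
    (T L).repr (KL L w) y = Finsupp.single w 1 y := by
  have e : KL L w = (KL L w - T L w) + T L w := by rw [sub_add_cancel]
  rw [e, map_add, Finsupp.add_apply, repr_eq_zero_of_mem_below L (KL_sub_mem_below L w) h,
    zero_add, Module.Basis.repr_self]

theorem linearIndependent_KL : LinearIndependent (AddMonoidAlgebra ℤ Γ) (KL L) := by
  classical
  rw [linearIndependent_iff]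
  intro l hl
  by_contra h0
  obtain ⟨w, hw, hmax⟩ := Finset.exists_max_image _ (fun w => cs.length w)
    (Finsupp.support_nonempty_iff.2 h0)
  have e := congrArg (fun x => (T L).repr x w) hl
  simp only [Finsupp.linearCombination_apply, Finsupp.sum, map_sum, map_smul, map_zero,
    Finsupp.coe_zero, Pi.zero_apply, Finsupp.finsetSum_apply, Finsupp.smul_apply] at e
  rw [Finset.sum_congr rfl fun y hy => by rw [repr_KL L (hmax y hy)]] at e
  simp only [Finsupp.single_apply, smul_eq_mul, mul_ite, mul_one, mul_zero,
    Finset.sum_ite_eq', hw, if_true] at e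
  exact Finsupp.mem_support_iff.1 hw e

theorem span_KL : ⊤ ≤ Submodule.span (AddMonoidAlgebra ℤ Γ) (Set.range (KL L)) := by
  have key : ∀ n, below L n ≤ Submodule.span (AddMonoidAlgebra ℤ Γ) (Set.range (KL L)) := by
    intro n
    induction n with
    | zero => simp [below]
    | succ n ih =>
      refine Submodule.span_le.2 ?_
      rintro _ ⟨y, hy, rfl⟩
      have hy : cs.length y < n + 1 := hy
      have e : T L y = KL L y - (KL L y - T L y) := by rw [sub_sub_cancel]
      rw [e]
      exact sub_mem (Submodule.subset_span ⟨y, rfl⟩)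
        (ih (below_mono L (by omega) (KL_sub_mem_below L y)))
  rw [← (T L).span_eq]
  refine Submodule.span_le.2 ?_
  rintro _ ⟨y, rfl⟩
  exact key _ (T_mem_below L (Nat.lt_succ_self _))

/-- The Kazhdan–Lusztig basis `(C_w)_{w ∈ W}` of the Hecke algebra. -/
noncomputable def C : Module.Basis W (AddMonoidAlgebra ℤ Γ) (HeckeAlgebra L) :=
  Module.Basis.mk (linearIndependent_KL L) (span_KL L)

/-- `C_w` is bar-invariant and lies in `T_w + ⨁_{y ∈ W} A_{< 0} T_y`. -/
theorem isKL_C (w : W) : IsKL L w (C L w) := by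
  rw [C, Module.Basis.mk_apply]; exact isKL_KL L w

end

end

end Hecke
/-! ## Cells, the function `a`, and Lusztig's conjectures -/

namespace Hecke

section

variable {B : Type*} {M : CoxeterMatrix B} {W : Type*} [Group W] {cs : CoxeterSystem M W}
  {Γ : Type*} [AddCommGroup Γ] [LinearOrder Γ] [IsOrderedAddMonoid Γ] (L : WeightFunction cs Γ)

/-- `x ←_L y`: the element `C_x` occurs in `C_s C_y` for some simple reflection `s`. -/
def LeftArrow (x y : W) : Prop :=
  ∃ i : B, (C L).repr (C L (cs.simple i) * C L y) x ≠ 0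

/-- `x ←_R y`: the element `C_x` occurs in `C_y C_s` for some simple reflection `s`. -/
def RightArrow (x y : W) : Prop :=
  ∃ i : B, (C L).repr (C L y * C L (cs.simple i)) x ≠ 0

/-- The Kazhdan–Lusztig left preorder `x ≤_L y`. -/
def LeftLE (x y : W) : Prop := Relation.ReflTransGen (LeftArrow L) x y

/-- The Kazhdan–Lusztig two-sided preorder `x ≤_LR y`. -/
def TwoSidedLE (x y : W) : Prop :=
  Relation.ReflTransGen (fun u w => LeftArrow L u w ∨ RightArrow L u w) x y

/-- The equivalence relation `x ∼_L y`. -/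
def LeftEquiv (x y : W) : Prop := LeftLE L x y ∧ LeftLE L y x

/-- The left cell containing `w`. -/
def leftCell (w : W) : Set W := {y | LeftEquiv L y w}

/-- The structure constants `h_{x,y,z}` defined by `C_x C_y = ∑_z h_{x,y,z} C_z`. -/
noncomputable def h (x y z : W) : AddMonoidAlgebra ℤ Γ := (C L).repr (C L x * C L y) z

theorem C_one : C L 1 = 1 := by
  have e := (existsUnique_isKL L 1).unique (isKL_C L 1)
    ⟨bar_T_one L, by rw [sub_self]; exact zero_mem _⟩
  rw [e, T_one]

/-- The symmetrizing form `τ`: the `A`-linear map with `τ(T_w) = δ_{1,w}`. -/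
noncomputable def tau : HeckeAlgebra L →ₗ[AddMonoidAlgebra ℤ Γ] AddMonoidAlgebra ℤ Γ :=
  (T L).coord 1

/-- `Δ(z) = -deg τ(C_z)`, with the convention `-(-∞) = +∞`. -/
noncomputable def Delta (z : W) : WithTop Γ :=
  match deg (tau L (C L z)) with
  | ⊥ => ⊤
  | (γ : Γ) => ((-γ : Γ) : WithTop Γ)

variable [Fintype W]

/-- Lusztig's function `a(z) = max_{x,y ∈ W} deg h_{x,y,z}`. The maximum, taken in `Γ ∪ {-∞}`,
is never `-∞` (see `Hecke.coe_a`). -/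
noncomputable def a (z : W) : Γ :=
  ((Finset.univ : Finset (W × W)).sup fun p => deg (h L p.1 p.2 z)).unbotD 0

theorem coe_unbotD_sup {ι : Type*} [Fintype ι] (f : ι → WithBot Γ) (i : ι) (hi : f i ≠ ⊥) :
    (((Finset.univ.sup f).unbotD 0 : Γ) : WithBot Γ) = Finset.univ.sup f := by
  have h2 : f i ≤ Finset.univ.sup f := Finset.le_sup (Finset.mem_univ i)
  generalize Finset.univ.sup f = S at h2
  cases S with
  | bot => exact absurd (le_bot_iff.1 h2) hi
  | coe γ => rfl

theorem coe_a (z : W) : ((a L z : Γ) : WithBot Γ) =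
    (Finset.univ : Finset (W × W)).sup fun p => deg (h L p.1 p.2 z) := by
  have h1 : deg (h L 1 z z) = ((0 : Γ) : WithBot Γ) := by
    have e : (1 : AddMonoidAlgebra ℤ Γ) = AddMonoidAlgebra.single 0 1 := rfl
    rw [h, C_one, one_mul, Module.Basis.repr_self, Finsupp.single_eq_same, deg, e,
      AddMonoidAlgebra.coeff_single, Finsupp.support_single _ one_ne_zero,
      Finset.max_singleton]
  exact coe_unbotD_sup _ (1, z) (h1.trans_ne WithBot.coe_ne_bot)

/-- `γ_{x,y,z}`: the coefficient of `v ^ a(z⁻¹)` in `h_{x,y,z⁻¹}`. -/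
noncomputable def gam (x y z : W) : ℤ := (h L x y z⁻¹).coeff (a L z⁻¹)

/-- The set `𝒟 = {z ∈ W | a(z) = Δ(z)}`. -/
def D : Set W := {z | ((a L z : Γ) : WithTop Γ) = Delta L z}

/-- Lusztig's conjecture `P₁`. -/
def P1 : Prop := ∀ z : W, ((a L z : Γ) : WithTop Γ) ≤ Delta L z

/-- Lusztig's conjecture `P₂`. -/
def P2 : Prop := ∀ d ∈ D L, ∀ x y : W, gam L x y d ≠ 0 → x = y⁻¹

/-- Lusztig's conjecture `P₄`. -/
def P4 : Prop := ∀ z' z : W, TwoSidedLE L z' z → a L z ≤ a L z'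

/-- Lusztig's conjecture `P₈`. -/
def P8 : Prop := ∀ x y z : W, gam L x y z ≠ 0 →
  LeftEquiv L x y⁻¹ ∧ LeftEquiv L y z⁻¹ ∧ LeftEquiv L z x⁻¹

/-- Lusztig's conjecture `P₉`. -/
def P9 : Prop := ∀ z' z : W, LeftLE L z' z → a L z' = a L z → LeftEquiv L z' z

/-- Lusztig's conjecture `P₁₃`: every left cell contains a unique element `d ∈ 𝒟`, and
`γ_{y⁻¹,y,d} ≠ 0` for all `y` in that cell. -/
def P13 : Prop := ∀ w : W, (∃! d, d ∈ leftCell L w ∧ d ∈ D L) ∧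
  ∀ d ∈ leftCell L w, d ∈ D L → ∀ y ∈ leftCell L w, gam L y⁻¹ y d ≠ 0

end

end Hecke

/-! Write `T_{w₀}⁻¹ C_y = ∑ λ_{x,y} C_x`. The plan is to show that, up to terms of lower degree,
`T_{w₀}⁻¹` acts on the Kazhdan–Lusztig basis as a signed permutation times powers of `v`. The
algebra involution `†` (`dag`), sending `T_s` to `-T_s⁻¹`, yields a basis dual to `(C_x)` for `τ`,
namely the elements `C_z† T_{w₀}` up to sign. This duality expresses `λ_{x,y}` as a signed sum of
the products `τ(C_{w₀z}) h_{z,w₀x,w₀y}` (`lam_eq_sum`), and it shows that `x ↦ w₀x` reverses the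
preorders. Then P₁ and P₄ bound `deg λ_{x,y}` by `a(w₀y) - a(y)`, and P₈ makes the coefficient
`n_{x,y}` in that degree (`lead`) vanish unless `x ∼_L y`. Inside a left cell, duality also bounds
`λ_{x,y}` from below, so it is a monomial there; the identity `T_{w₀} T_{w₀}⁻¹ = 1` then gives `∑_z
n_{z,x} n_{x,z} = 1`. Computing `τ(C_{x⁻¹} T_{w₀}⁻² C_x)` in two ways and using the almost
orthonormality of the `C_x` gives `∑_z n_{z,x}² = 1`. Since the `n_{z,x}` are integers, each column
has a single nonzero entry, at `z = σ(x)`, and `σ` is an involution preserving left cells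
(`P8.exists_involution`). By induction on `n`, the extreme coefficient of `τ(T_{w₀}⁻ⁿ C_w)` is, up
to a nonzero factor, that of `τ(C_{σⁿ(w)})`, which is nonzero exactly when `σⁿ(w) ∈ 𝒟`. For odd `n`
it remains to see that `σ(w) ∈ 𝒟` if and only if `w₀w⁻¹ ∈ 𝒟`. By P₂, one term of the sum for
`n_{d,w}` survives when `d` and `w₀w` lie in `𝒟` and `d ∼_L w`, and P₁₃ makes it nonzero. -/

namespace CoxeterSystem

/-! ### Inversions and the longest element of a finite Coxeter group. -/

section

variable {B : Type*} {M : CoxeterMatrix B} {W : Type*} [Group W] (cs : CoxeterSystem M W)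

/-- The parity of the number of occurrences of `t` in the right inversion sequence of a word
for `w`. -/
noncomputable def invParity (w t : W) : ZMod 2 :=
  (cs.lift ⟨cs.signPerm, cs.signPerm_isLiftable⟩ w (t, 0)).2

theorem lift_signPerm_apply (w t : W) (e : ZMod 2) :
    cs.lift ⟨cs.signPerm, cs.signPerm_isLiftable⟩ w (t, e) =
      (w * t * w⁻¹, e + cs.invParity w t) := by
  classical
  obtain ⟨ω, -, rfl⟩ := cs.exists_isReduced w
  rw [invParity, lift_signPerm_wordProd, lift_signPerm_wordProd, zero_add]

/-- Cocycle rule: it records that the signed permutations form a group action. -/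
theorem invParity_mul (u y t : W) :
    cs.invParity (u * y) t = cs.invParity y t + cs.invParity u (y * t * y⁻¹) := by
  rw [invParity, map_mul, Equiv.Perm.mul_apply, lift_signPerm_apply, lift_signPerm_apply, zero_add]

theorem invParity_one (t : W) : cs.invParity 1 t = 0 := by simp [invParity]

theorem invParity_simple (i : B) : cs.invParity (cs.simple i) (cs.simple i) = 1 := by
  rw [invParity, lift_apply_simple]
  simp [signPerm]

/-- For `t = x s x⁻¹`, the contributions of `x` and `x⁻¹` cancel by the cocycle rule for `x x⁻¹ =
1`, leaving only that of `s`. -/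
theorem invParity_self {t : W} (ht : cs.IsReflection t) : cs.invParity t t = 1 := by
  obtain ⟨x, i, rfl⟩ := ht
  have h1 := cs.invParity_mul x x⁻¹ (x * cs.simple i * x⁻¹)
  rw [mul_inv_cancel, invParity_one] at h1
  have e : x⁻¹ * (x * cs.simple i * x⁻¹) * x⁻¹⁻¹ = cs.simple i := by group
  rw [e] at h1
  rw [invParity_mul, invParity_mul, e]
  simp only [cs.inv_simple, cs.simple_mul_simple_self, one_mul, invParity_simple]
  rw [add_left_comm, ← h1, add_zero]

/-- Odd parity forces `t` to occur in the inversion sequence of a reduced word, so it is an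
inversion. If the parity of `w` were even, that of `w t` would be odd, and the first implication
applied to `w t` would give `w t > w`. -/
theorem invParity_eq_one_iff {w t : W} (ht : cs.IsReflection t) :
    cs.invParity w t = 1 ↔ cs.length (w * t) < cs.length w := by
  classical
  have key : ∀ w, cs.invParity w t = 1 → cs.length (w * t) < cs.length w := by
    intro w h
    obtain ⟨ω, hω, rfl⟩ := cs.exists_isReduced w
    rw [invParity, lift_signPerm_wordProd, zero_add] at h
    refine (cs.isRightInversion_of_mem_rightInvSeq hω ?_).2
    by_contra hn
    rw [List.count_eq_zero_of_not_mem hn] at h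
    simp at h
  refine ⟨key w, fun h => ?_⟩
  by_contra h1
  have h0 : cs.invParity w t = 0 := by
    revert h1; generalize cs.invParity w t = a; revert a; decide
  have := key (w * t) (by
    rw [invParity_mul, cs.invParity_self ht, mul_inv_cancel_right, h0, add_zero])
  rw [mul_assoc, ht.mul_self, mul_one] at this
  exact absurd this h.asymm

section Longest

variable {cs} {w₀ : W} (hw₀ : ∀ x : W, cs.length x ≤ cs.length w₀)
include hw₀

/-- Every reflection is an inversion of `w₀`. When `s y > y`, the reflection `y⁻¹ s y` is not an
inversion of `y`, so the cocycle rule makes `s` an inversion of `w₀ y⁻¹`: each further letter of `x`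
lowers the length by one. -/
theorem length_longest_mul_inv (x : W) :
    cs.length (w₀ * x⁻¹) + cs.length x = cs.length w₀ := by
  obtain ⟨ω, hω, rfl⟩ := cs.exists_isReduced x
  induction ω with
  | nil => simp
  | cons i ω ih =>
    have hω' : cs.IsReduced ω := hω.drop 1
    have h := ih hω'
    set y := cs.wordProd ω with hy
    have ht : cs.IsReflection (y⁻¹ * cs.simple i * y) := ⟨y⁻¹, i, by rw [inv_inv]⟩
    have h1 : cs.invParity w₀ (y⁻¹ * cs.simple i * y) = 1 := by
      rw [cs.invParity_eq_one_iff ht]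
      exact lt_of_le_of_ne (hw₀ _) (ht.length_mul_left_ne _)
    have h2 : cs.length (cs.simple i * y) = cs.length y + 1 := by
      rw [hy, ← cs.wordProd_cons, hω.eq, hω'.eq, List.length_cons]
    have h3 : cs.invParity y (y⁻¹ * cs.simple i * y) ≠ 1 := by
      rw [Ne, cs.invParity_eq_one_iff ht]
      rw [show y * (y⁻¹ * cs.simple i * y) = cs.simple i * y by group]
      omega
    have h4 := cs.invParity_mul (w₀ * y⁻¹) y (y⁻¹ * cs.simple i * y)
    rw [show y * (y⁻¹ * cs.simple i * y) * y⁻¹ = cs.simple i by group, inv_mul_cancel_right,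
      h1] at h4
    have h5 : cs.invParity (w₀ * y⁻¹) (cs.simple i) = 1 := by
      revert h3 h4
      generalize cs.invParity y _ = a
      generalize cs.invParity (w₀ * y⁻¹) _ = b
      revert a b; decide
    rw [cs.invParity_eq_one_iff (cs.isReflection_simple i)] at h5
    have h6 := cs.length_mul_simple (w₀ * y⁻¹) i
    rw [cs.wordProd_cons, mul_inv_rev, cs.inv_simple, ← mul_assoc, ← hy, h2]
    omega

theorem length_longest_mul (x : W) : cs.length (w₀ * x) + cs.length x = cs.length w₀ := by
  simpa using length_longest_mul_inv hw₀ x⁻¹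

theorem longest_mul_self : w₀ * w₀ = 1 := by
  have := length_longest_mul hw₀ w₀
  exact cs.length_eq_zero_iff.1 (by omega)

theorem longest_inv : w₀⁻¹ = w₀ := inv_eq_of_mul_eq_one_left (longest_mul_self hw₀)

theorem length_mul_longest (x : W) : cs.length (x * w₀) + cs.length x = cs.length w₀ := by
  have := length_longest_mul hw₀ x⁻¹
  rw [← cs.length_inv (w₀ * x⁻¹), cs.length_inv x, mul_inv_rev, inv_inv, longest_inv hw₀] at this
  exact this

theorem length_longest_conj (x : W) : cs.length (w₀ * x * w₀) = cs.length x := by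
  have h1 := length_mul_longest hw₀ (w₀ * x)
  have h2 := length_longest_mul hw₀ x
  omega

theorem exists_longest_conj_simple (i : B) : ∃ j, w₀ * cs.simple i * w₀ = cs.simple j :=
  cs.length_eq_one_iff.1 (by rw [length_longest_conj hw₀, cs.length_simple])

end Longest

end

end CoxeterSystem

namespace Hecke

/-! ### Degrees and extreme coefficients in the group algebra. -/

section CoefficientRing

set_option linter.unusedSectionVars false

variable {Γ : Type*} [AddCommGroup Γ] [LinearOrder Γ]

theorem deg_le_iff {a : AddMonoidAlgebra ℤ Γ} {g : Γ} :
    deg a ≤ (g : WithBot Γ) ↔ ∀ γ, a.coeff γ ≠ 0 → γ ≤ g := by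
  simp [deg, Finset.max_le_iff]

theorem deg_eq_iff {a : AddMonoidAlgebra ℤ Γ} {g : Γ} (h : deg a ≤ (g : WithBot Γ)) :
    deg a = (g : WithBot Γ) ↔ a.coeff g ≠ 0 := by
  constructor
  · intro e
    exact Finsupp.mem_support_iff.1 (Finset.mem_of_max e)
  · intro e
    exact le_antisymm h (Finset.le_max (Finsupp.mem_support_iff.2 e))

theorem deg_zero : deg (0 : AddMonoidAlgebra ℤ Γ) = ⊥ := by simp [deg]

theorem deg_neg (a : AddMonoidAlgebra ℤ Γ) : deg (-a) = deg a := by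
  rw [deg, deg]; congr 1; ext; simp

theorem deg_sum_le {ι : Type*} {s : Finset ι} {f : ι → AddMonoidAlgebra ℤ Γ} {g : WithBot Γ}
    (h : ∀ i ∈ s, deg (f i) ≤ g) : deg (∑ i ∈ s, f i) ≤ g := by
  classical
  rw [deg, Finset.max_le_iff]
  intro γ hγ
  rw [Finsupp.mem_support_iff, AddMonoidAlgebra.coeff_sum, Finsupp.finsetSum_apply] at hγ
  obtain ⟨i, hi, hne⟩ := Finset.exists_ne_zero_of_sum_ne_zero hγ
  exact (Finset.le_max (Finsupp.mem_support_iff.2 hne)).trans (h i hi)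

theorem coeff_zero_of_mem_negA {a : AddMonoidAlgebra ℤ Γ} (h : a ∈ negA Γ) : a.coeff 0 = 0 := by
  by_contra h'
  exact lt_irrefl _ (h 0 h')

omit [LinearOrder Γ] in
theorem exists_add_of_coeff_mul_ne_zero {a b : AddMonoidAlgebra ℤ Γ} {γ : Γ}
    (h : (a * b).coeff γ ≠ 0) : ∃ x y, a.coeff x ≠ 0 ∧ b.coeff y ≠ 0 ∧ x + y = γ := by
  classical
  rw [AddMonoidAlgebra.coeff_mul] at h
  obtain ⟨x, hx, h⟩ := Finset.exists_ne_zero_of_sum_ne_zero h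
  obtain ⟨y, hy, h⟩ := Finset.exists_ne_zero_of_sum_ne_zero h
  refine ⟨x, y, Finsupp.mem_support_iff.1 hx, Finsupp.mem_support_iff.1 hy, ?_⟩
  by_contra h'
  exact h (if_neg h')

variable [IsOrderedAddMonoid Γ]

theorem deg_mul_le {a b : AddMonoidAlgebra ℤ Γ} {g g' : Γ} (ha : deg a ≤ (g : WithBot Γ))
    (hb : deg b ≤ (g' : WithBot Γ)) : deg (a * b) ≤ ((g + g' : Γ) : WithBot Γ) := by
  rw [deg_le_iff] at ha hb ⊢
  intro γ hγ
  obtain ⟨x, y, hx, hy, rfl⟩ := exists_add_of_coeff_mul_ne_zero hγ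
  exact add_le_add (ha x hx) (hb y hy)

/-- Exponents bounded by `g` and `g'` can add up to `g + g'` only if both bounds are attained. The
bounds need not be sharp, so both sides may vanish; this is how all leading coefficients below are
compared. -/
theorem coeff_mul_of_deg_le {a b : AddMonoidAlgebra ℤ Γ} {g g' : Γ} (ha : deg a ≤ (g : WithBot Γ))
    (hb : deg b ≤ (g' : WithBot Γ)) : (a * b).coeff (g + g') = a.coeff g * b.coeff g' := by
  rw [deg_le_iff] at ha hb
  refine AddMonoidAlgebra.coeff_mul_add_of_uniqueAdd fun x y hx hy e => ?_
  have h1 := ha x (Finsupp.mem_support_iff.1 hx)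
  have h2 := hb y (Finsupp.mem_support_iff.1 hy)
  exact (add_eq_add_iff_eq_and_eq h1 h2).1 e

theorem mul_mem_negA {a b : AddMonoidAlgebra ℤ Γ} (ha : a ∈ negA Γ) (hb : b ∈ negA Γ) :
    a * b ∈ negA Γ := by
  intro γ hγ
  obtain ⟨x, y, hx, hy, rfl⟩ := exists_add_of_coeff_mul_ne_zero hγ
  exact add_neg (ha x hx) (hb y hy)

end CoefficientRing

end Hecke

namespace Hecke

/-! ### Bar, the anti-automorphism, the sign involution and the trace. -/

section

variable {B : Type*} {M : CoxeterMatrix B} {W : Type*} [Group W] {cs : CoxeterSystem M W}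
  {Γ : Type*} [AddCommGroup Γ] [LinearOrder Γ] (L : WeightFunction cs Γ)

variable {L} in
@[elab_as_elim]
theorem basis_induction {P : HeckeAlgebra L → Prop}
    (b : Module.Basis W (AddMonoidAlgebra ℤ Γ) (HeckeAlgebra L)) (x : HeckeAlgebra L)
    (basis : ∀ w, P (b w))
    (add : ∀ x y, P x → P y → P (x + y))
    (smul : ∀ (a : AddMonoidAlgebra ℤ Γ) x, P x → P (a • x)) : P x := by
  have hx : x ∈ Submodule.span (AddMonoidAlgebra ℤ Γ) (Set.range b) := by
    rw [b.span_eq]; trivial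
  induction hx using Submodule.span_induction with
  | zero => simpa using smul 0 _ (basis 1)
  | mem x hx => obtain ⟨w, rfl⟩ := hx; exact basis w
  | add x y _ _ hx hy => exact add x y hx hy
  | smul a x _ hx => exact smul a x hx

variable {L} in
@[elab_as_elim]
-- Each `T_w` is a product of generators, so multiplicativity of a linear or semilinear map need
-- only be checked for left multiplication by `T_s`.
theorem generator_induction {P : HeckeAlgebra L → Prop} (x : HeckeAlgebra L) (one : P 1)
    (simple_mul : ∀ i x, P x → P (T L (cs.simple i) * x))
    (add : ∀ x y, P x → P y → P (x + y))
    (smul : ∀ (a : AddMonoidAlgebra ℤ Γ) x, P x → P (a • x)) : P x := by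
  refine basis_induction (T L) x (fun w => ?_) add smul
  obtain ⟨ω, hω, rfl⟩ := cs.exists_isReduced w
  rw [T_wordProd L hω]
  clear hω
  induction ω with
  | nil => simpa using one
  | cons i ω ih =>
    rw [List.map_cons, List.prod_cons, ← T_simple]
    exact simple_mul i _ ih

theorem T_mul_simple_of_lt {i : B} {w : W} (h : ¬ cs.IsRightDescent w i) :
    T L w * T L (cs.simple i) = T L (w * cs.simple i) :=
  T_mul_T L (by rw [cs.length_simple]; exact cs.not_isRightDescent_iff.1 h)

theorem T_mul_simple_of_gt {i : B} {w : W} (h : cs.IsRightDescent w i) :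
    T L w * T L (cs.simple i) = T L (w * cs.simple i) + q L i • T L w := by
  have h' := cs.isRightDescent_iff_not_isRightDescent_mul.1 h
  have e := T_mul_simple_of_lt L h'
  rw [cs.simple_mul_simple_cancel_right] at e
  rw [← e, mul_assoc, T_simple_mul_self, mul_add, mul_one, mul_smul_comm, q]

theorem bar_one : bar L 1 = 1 := by rw [← T_one, bar_T_one]

theorem bar_T_simple (i : B) : bar L (T L (cs.simple i)) = T L (cs.simple i) - q L i • 1 := by
  have := bar_T_simple_mul L i 1
  rwa [mul_one, bar_one, mul_one] at this

theorem bar_mul (x y : HeckeAlgebra L) : bar L (x * y) = bar L x * bar L y := by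
  induction x using generator_induction with
  | one => rw [one_mul, bar_one, one_mul]
  | simple_mul i x hx => rw [mul_assoc, bar_T_simple_mul, hx, bar_T_simple_mul, mul_assoc]
  | add x x' hx hx' => rw [add_mul, bar_add, hx, hx', bar_add, add_mul]
  | smul a x hx => rw [smul_mul_assoc, bar_smul, hx, bar_smul, smul_mul_assoc]

/-! ### The anti-automorphism `T_w ↦ T_{w⁻¹}` -/

/-- The `A`-linear anti-automorphism `T_w ↦ T_{w⁻¹}` of the Hecke algebra. -/
noncomputable def flat : HeckeAlgebra L →ₗ[AddMonoidAlgebra ℤ Γ] HeckeAlgebra L :=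
  (T L).constr (AddMonoidAlgebra ℤ Γ) fun w => T L w⁻¹

theorem flat_T (w : W) : flat L (T L w) = T L w⁻¹ := (T L).constr_basis _ _ _

theorem flat_one : flat L 1 = 1 := by rw [← T_one, flat_T, inv_one]

theorem flat_T_simple_mul (i : B) (x : HeckeAlgebra L) :
    flat L (T L (cs.simple i) * x) = flat L x * T L (cs.simple i) := by
  induction x using basis_induction (T L) with
  | basis w =>
    by_cases h : cs.IsLeftDescent w i
    · rw [T_simple_mul_of_gt L h, map_add, map_smul, flat_T, flat_T,
        T_mul_simple_of_gt L (cs.isRightDescent_inv_iff.2 h), mul_inv_rev, cs.inv_simple]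
    · rw [T_simple_mul_of_lt L h, flat_T, flat_T,
        T_mul_simple_of_lt L (fun h' => h (cs.isRightDescent_inv_iff.1 h')), mul_inv_rev,
        cs.inv_simple]
  | add x y hx hy => rw [mul_add, map_add, hx, hy, map_add, add_mul]
  | smul a x hx => rw [mul_smul_comm, map_smul, hx, map_smul, smul_mul_assoc]

theorem flat_mul (x y : HeckeAlgebra L) : flat L (x * y) = flat L y * flat L x := by
  induction x using generator_induction with
  | one => rw [one_mul, flat_one, mul_one]
  | simple_mul i x hx => rw [mul_assoc, flat_T_simple_mul, hx, flat_T_simple_mul, mul_assoc]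
  | add x x' hx hx' => rw [add_mul, map_add, hx, hx', map_add, mul_add]
  | smul a x hx => rw [smul_mul_assoc, map_smul, hx, map_smul, mul_smul_comm]

theorem flat_bar (x : HeckeAlgebra L) : flat L (bar L x) = bar L (flat L x) := by
  induction x using generator_induction with
  | one => rw [bar_one, flat_one, bar_one]
  | simple_mul i x hx =>
    rw [bar_mul, flat_mul, hx, flat_T_simple_mul, bar_mul, bar_T_simple, map_sub, map_smul,
      flat_one, flat_T, cs.inv_simple]
  | add x y hx hy => rw [bar_add, map_add, hx, hy, map_add, bar_add]
  | smul a x hx => rw [bar_smul, map_smul, hx, map_smul, bar_smul]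

theorem repr_flat (x : HeckeAlgebra L) (w : W) :
    (T L).repr (flat L x) w = (T L).repr x w⁻¹ := by
  classical
  induction x using basis_induction (T L) with
  | basis y =>
    rw [flat_T, Module.Basis.repr_self, Module.Basis.repr_self, Finsupp.single_apply,
      Finsupp.single_apply]
    simp only [inv_eq_iff_eq_inv]
  | add x y hx hy => simp [hx, hy]
  | smul a x hx => simp [hx]

/-! ### The involution `T_s ↦ -T_s⁻¹` -/

/-- The sign `(-1) ^ ℓ(w)` as an element of `A`. -/
noncomputable def sgn (_ : WeightFunction cs Γ) (w : W) : AddMonoidAlgebra ℤ Γ :=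
  (-1) ^ cs.length w

theorem sgn_mul_self (w : W) : sgn L w * sgn L w = 1 := by
  rw [sgn, ← pow_add, Even.neg_one_pow ⟨_, rfl⟩]

theorem sgn_eq_or (w : W) : sgn L w = 1 ∨ sgn L w = -1 := neg_one_pow_eq_or _ _

theorem sgn_inv (w : W) : sgn L w⁻¹ = sgn L w := by rw [sgn, sgn, cs.length_inv]

theorem barA_sgn (w : W) : barA (sgn L w) = sgn L w := by simp [sgn]

theorem coeff_sgn_mul (w : W) (p : AddMonoidAlgebra ℤ Γ) (g : Γ) :
    (sgn L w * p).coeff g = (-1) ^ cs.length w * p.coeff g := by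
  rw [sgn]
  rcases neg_one_pow_eq_or (AddMonoidAlgebra ℤ Γ) (cs.length w) with h | h <;>
    rcases Nat.even_or_odd (cs.length w) with h' | h' <;> simp [h'.neg_one_pow]

theorem deg_sgn_mul (w : W) (p : AddMonoidAlgebra ℤ Γ) : deg (sgn L w * p) = deg p := by
  rcases sgn_eq_or L w with h | h <;> simp [h, deg_neg]

/-- The `A`-algebra involution `T_w ↦ (-1) ^ ℓ(w) T_{w⁻¹}⁻¹` of the Hecke algebra. -/
noncomputable def dag : HeckeAlgebra L →ₗ[AddMonoidAlgebra ℤ Γ] HeckeAlgebra L :=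
  (T L).constr (AddMonoidAlgebra ℤ Γ) fun w => sgn L w • bar L (T L w)

theorem dag_T (w : W) : dag L (T L w) = sgn L w • bar L (T L w) := (T L).constr_basis _ _ _

theorem dag_one : dag L 1 = 1 := by
  rw [← T_one, dag_T, bar_T_one, sgn, cs.length_one, pow_zero, one_smul]

theorem dag_T_simple (i : B) :
    dag L (T L (cs.simple i)) = q L i • 1 - T L (cs.simple i) := by
  rw [dag_T, bar_T_simple, sgn, cs.length_simple, pow_one, neg_smul, one_smul, neg_sub]

/-- The quadratic relation `X² = 1 + qX` has both `T_s` and `-T_s⁻¹` as solutions; this is why `dag`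
respects products. -/
theorem dag_T_simple_mul_self (i : B) :
    dag L (T L (cs.simple i)) * dag L (T L (cs.simple i)) =
      1 + q L i • dag L (T L (cs.simple i)) := by
  rw [dag_T_simple, ← neg_sub, neg_mul_neg, mul_sub, T_simple_inv_mul, mul_smul_comm, mul_one,
    smul_neg, sub_eq_add_neg]

theorem dag_T_simple_mul_of_lt {i : B} {w : W} (h : ¬ cs.IsLeftDescent w i) :
    dag L (T L (cs.simple i * w)) = dag L (T L (cs.simple i)) * dag L (T L w) := by
  rw [dag_T, ← T_simple_mul_of_lt L h, bar_mul, dag_T, dag_T, smul_mul_smul_comm]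
  congr 1
  rw [sgn, sgn, sgn, cs.not_isLeftDescent_iff.1 h, cs.length_simple, pow_succ, mul_comm, pow_one]

theorem dag_T_simple_mul (i : B) (x : HeckeAlgebra L) :
    dag L (T L (cs.simple i) * x) = dag L (T L (cs.simple i)) * dag L x := by
  induction x using basis_induction (T L) with
  | basis w =>
    by_cases h : cs.IsLeftDescent w i
    · have h' := cs.isLeftDescent_iff_not_isLeftDescent_mul.1 h
      have e := dag_T_simple_mul_of_lt L h'
      rw [cs.simple_mul_simple_cancel_left] at e
      rw [T_simple_mul_of_gt L h, map_add, map_smul, e, ← mul_assoc, dag_T_simple_mul_self,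
        add_mul, one_mul, smul_mul_assoc]
    · rw [T_simple_mul_of_lt L h, dag_T_simple_mul_of_lt L h]
  | add x y hx hy => rw [mul_add, map_add, hx, hy, map_add, mul_add]
  | smul a x hx => rw [mul_smul_comm, map_smul, hx, map_smul, mul_smul_comm]

theorem dag_mul (x y : HeckeAlgebra L) : dag L (x * y) = dag L x * dag L y := by
  induction x using generator_induction with
  | one => rw [one_mul, dag_one, one_mul]
  | simple_mul i x hx => rw [mul_assoc, dag_T_simple_mul, hx, dag_T_simple_mul, mul_assoc]
  | add x x' hx hx' => rw [add_mul, map_add, hx, hx', map_add, add_mul]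
  | smul a x hx => rw [smul_mul_assoc, map_smul, hx, map_smul, smul_mul_assoc]

theorem dag_bar (x : HeckeAlgebra L) : dag L (bar L x) = bar L (dag L x) := by
  induction x using generator_induction with
  | one => rw [bar_one, dag_one, bar_one]
  | simple_mul i x hx =>
    rw [bar_mul, dag_mul, hx, dag_T_simple_mul, bar_mul, bar_T_simple, map_sub, map_smul,
      dag_one, dag_T_simple, bar_sub, bar_smul, barA_q, bar_one, bar_T_simple, neg_smul]
    congr 1
    abel
  | add x y hx hy => rw [bar_add, map_add, hx, hy, map_add, bar_add]
  | smul a x hx => rw [bar_smul, map_smul, hx, map_smul, bar_smul]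

theorem dag_dag (x : HeckeAlgebra L) : dag L (dag L x) = x := by
  induction x using generator_induction with
  | one => rw [dag_one, dag_one]
  | simple_mul i x hx =>
    rw [dag_mul, dag_mul, hx, dag_T_simple, map_sub, map_smul, dag_one, dag_T_simple, sub_sub_cancel]
  | add x y hx hy => rw [map_add, map_add, hx, hy]
  | smul a x hx => rw [map_smul, map_smul, hx]

/-! ### The symmetrizing trace -/

open Classical in
-- Induction on the length of the left factor, moving its last simple reflection over to the right
-- factor.
theorem tau_T_mul_T (x y : W) : tau L (T L x * T L y) = if x * y = 1 then 1 else 0 := by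
  have h1 : ∀ w, tau L (T L w) = if w = 1 then 1 else 0 := by
    intro w
    rw [tau, Module.Basis.coord_apply, Module.Basis.repr_self, Finsupp.single_apply]
  induction hn : cs.length x generalizing x y with
  | zero =>
    rw [cs.length_eq_zero_iff.1 hn, T_one, one_mul, one_mul, h1]
  | succ n ih =>
    have hx : x ≠ 1 := by rintro rfl; simp at hn
    obtain ⟨i, hi⟩ := cs.exists_rightDescent_of_ne_one hx
    have hl := cs.isRightDescent_iff.1 hi
    obtain ⟨u, rfl⟩ : ∃ u, x = u * cs.simple i := ⟨x * cs.simple i, by simp⟩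
    rw [cs.simple_mul_simple_cancel_right] at hl
    rw [← T_mul_simple_of_lt L (cs.not_isRightDescent_iff.2 hl.symm), mul_assoc]
    by_cases hy : cs.IsLeftDescent y i
    · rw [T_simple_mul_of_gt L hy, mul_add, map_add, mul_smul_comm, map_smul,
        ih _ _ (by omega), ih _ _ (by omega), if_neg (c := u * y = 1), smul_zero, add_zero, mul_assoc]
      -- The extra term from the quadratic relation is zero: `u y = 1` with `s y < y` would give `u
      -- s < u`, against the choice of `u`.
      intro e
      rw [← inv_eq_iff_mul_eq_one] at e
      subst e
      rw [cs.isLeftDescent_inv_iff, cs.isRightDescent_iff] at hy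
      omega
    · rw [T_simple_mul_of_lt L hy, ih _ _ (by omega), mul_assoc]

theorem tau_mul_comm (x y : HeckeAlgebra L) : tau L (x * y) = tau L (y * x) := by
  classical
  induction x using basis_induction (T L) with
  | basis w =>
    induction y using basis_induction (T L) with
    | basis u => rw [tau_T_mul_T, tau_T_mul_T, mul_eq_one_comm]
    | add x y hx hy => rw [mul_add, add_mul, map_add, map_add, hx, hy]
    | smul a x hx => rw [mul_smul_comm, smul_mul_assoc, map_smul, map_smul, hx]
  | add x y hx hy => rw [mul_add, add_mul, map_add, map_add, hx, hy]
  | smul a x hx => rw [mul_smul_comm, smul_mul_assoc, map_smul, map_smul, hx]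

theorem tau_mul_T (x : HeckeAlgebra L) (w : W) : tau L (x * T L w) = (T L).repr x w⁻¹ := by
  classical
  induction x using basis_induction (T L) with
  | basis u =>
    rw [tau_T_mul_T, Module.Basis.repr_self, Finsupp.single_apply]
    simp only [mul_eq_one_iff_eq_inv]
  | add x y hx hy => rw [add_mul, map_add, hx, hy, map_add, Finsupp.add_apply]
  | smul a x hx => rw [smul_mul_assoc, map_smul, hx, map_smul, Finsupp.smul_apply]

theorem tau_flat (x : HeckeAlgebra L) : tau L (flat L x) = tau L x := by
  rw [tau, Module.Basis.coord_apply, Module.Basis.coord_apply, repr_flat, inv_one]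

end

end Hecke

namespace Hecke

/-! ### Symmetries and almost orthonormality of the Kazhdan–Lusztig basis. -/

section

variable {B : Type*} {M : CoxeterMatrix B} {W : Type*} [Group W] {cs : CoxeterSystem M W}
  {Γ : Type*} [AddCommGroup Γ] [LinearOrder Γ] [IsOrderedAddMonoid Γ] (L : WeightFunction cs Γ)

variable {L} in
theorem IsKL.eq_C {w : W} {c : HeckeAlgebra L} (hc : IsKL L w c) : c = C L w :=
  (existsUnique_isKL L w).unique hc (isKL_C L w)

theorem bar_C (w : W) : bar L (C L w) = C L w := (isKL_C L w).1

open Classical in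
theorem repr_C_sub_mem_negA (w y : W) :
    (T L).repr (C L w) y - (if w = y then 1 else 0) ∈ negA Γ := by
  have := (isKL_C L w).2 y
  rwa [map_sub, Finsupp.sub_apply, Module.Basis.repr_self, Finsupp.single_apply] at this

theorem flat_C (w : W) : flat L (C L w) = C L w⁻¹ := by
  refine IsKL.eq_C ⟨by rw [← flat_bar, bar_C], fun y => ?_⟩
  rw [← flat_T, ← map_sub, repr_flat]
  exact (isKL_C L w).2 _

theorem C_repr_flat (x : HeckeAlgebra L) (w : W) :
    (C L).repr (flat L x) w = (C L).repr x w⁻¹ := by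
  classical
  induction x using basis_induction (C L) with
  | basis y =>
    rw [flat_C, Module.Basis.repr_self, Module.Basis.repr_self, Finsupp.single_apply,
      Finsupp.single_apply]
    simp only [inv_eq_iff_eq_inv]
  | add x y hx hy => simp [hx, hy]
  | smul a x hx => simp [hx]

theorem C_repr_bar (x : HeckeAlgebra L) (w : W) :
    (C L).repr (bar L x) w = barA ((C L).repr x w) := by
  classical
  induction x using basis_induction (C L) with
  | basis y =>
    rw [bar_C, Module.Basis.repr_self, Finsupp.single_apply]
    split_ifs <;> simp
  | add x y hx hy => simp [bar_add, hx, hy]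
  | smul a x hx => simp [bar_smul, hx]

theorem h_inv (x y z : W) : h L x⁻¹ y⁻¹ z⁻¹ = h L y x z := by
  rw [h, h, ← flat_C, ← flat_C, ← flat_mul, C_repr_flat, inv_inv]

theorem tau_C_inv (z : W) : tau L (C L z⁻¹) = tau L (C L z) := by
  rw [← flat_C, tau_flat]

theorem Delta_inv (z : W) : Delta L z⁻¹ = Delta L z := by
  rw [Delta, Delta, tau_C_inv]

theorem C_simple (i : B) :
    C L (cs.simple i) = T L (cs.simple i) + v (-L.toFun (cs.simple i)) • 1 := by
  refine (IsKL.eq_C ⟨?_, ?_⟩).symm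
  · rw [bar_add, bar_smul, barA_v, neg_neg, bar_one, bar_T_simple, q, sub_smul]
    abel
  · rw [add_sub_cancel_left, ← T_one]
    exact smul_T_mem_negH L (v_neg_mem_negA (L.pos i)) 1

theorem dag_C_simple (i : B) : dag L (C L (cs.simple i)) =
    (v (L.toFun (cs.simple i)) + v (-L.toFun (cs.simple i))) • 1 - C L (cs.simple i) := by
  rw [C_simple, map_add, map_smul, dag_one, dag_T_simple, q, sub_smul, add_smul]
  abel

section Fin

variable [Fintype W]

theorem deg_h_le (x y z : W) : deg (h L x y z) ≤ ((a L z : Γ) : WithBot Γ) := by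
  rw [coe_a]
  have key : ∀ f : W × W → WithBot Γ, f (x, y) ≤ Finset.univ.sup f :=
    fun f => Finset.le_sup (Finset.mem_univ _)
  exact key fun p => deg (h L p.1 p.2 z)

/-- Used to carry the function `a` along symmetries of the structure constants, here inversion and
conjugation by `w₀`. -/
theorem a_le_a {z z' : W} (H : ∀ x y, ∃ x' y', h L x y z = h L x' y' z') : a L z ≤ a L z' := by
  rw [← WithBot.coe_le_coe, coe_a]
  refine Finset.sup_le fun p _ => ?_
  obtain ⟨x', y', e⟩ := H p.1 p.2
  rw [e]
  exact deg_h_le L x' y' z'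

theorem a_inv (z : W) : a L z⁻¹ = a L z := by
  apply le_antisymm
  · exact a_le_a L fun x y => ⟨y⁻¹, x⁻¹, by rw [← h_inv, inv_inv]⟩
  · exact a_le_a L fun x y => ⟨y⁻¹, x⁻¹, (h_inv L y x z).symm⟩

theorem inv_mem_D {z : W} : z⁻¹ ∈ D L ↔ z ∈ D L := by
  simp only [D, Set.mem_ofPred_eq, a_inv, Delta_inv]

omit [IsOrderedAddMonoid Γ] in
theorem tau_mul (x y : HeckeAlgebra L) :
    tau L (x * y) = ∑ w, (T L).repr x w * (T L).repr y w⁻¹ := by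
  classical
  induction y using basis_induction (T L) with
  | basis u =>
    rw [tau_mul_T, Finset.sum_eq_single u⁻¹]
    · simp
    · intro w _ hw
      rw [Module.Basis.repr_self, Finsupp.single_apply, if_neg, mul_zero]
      rintro rfl
      exact hw (inv_inv w).symm
    · simp
  | add y y' hy hy' => simp [mul_add, hy, hy', Finset.sum_add_distrib]
  | smul b y hy =>
    simp only [mul_smul_comm, map_smul, hy, Finsupp.smul_apply, smul_eq_mul, Finset.mul_sum]
    exact Finset.sum_congr rfl fun w _ => by ring

open Classical in
theorem mul_sub_ite_mem_negA {x y : AddMonoidAlgebra ℤ Γ} {p r : Prop}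
    (hx : x - (if p then 1 else 0) ∈ negA Γ) (hy : y - (if r then 1 else 0) ∈ negA Γ) :
    x * y - (if p ∧ r then 1 else 0) ∈ negA Γ := by
  -- With `x = [p] + α` and `y = [r] + β`, what remains of `x y` is `αβ + [p]β + [r]α`, each term of
  -- which lies in `A_{<0}`.
  have e : x * y - (if p ∧ r then 1 else 0) =
      (x - (if p then 1 else 0)) * (y - (if r then 1 else 0)) +
        (if p then (y - (if r then 1 else 0)) else 0) +
        (if r then (x - (if p then 1 else 0)) else 0) := by
    by_cases p <;> by_cases r <;> simp [*] <;> ring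
  rw [e]
  refine add_mem (add_mem (mul_mem_negA hx hy) ?_) ?_
  · by_cases p <;> simp [*]
  · by_cases r <;> simp [*]

open Classical in
/-- The Kazhdan–Lusztig basis is almost orthonormal. -/
theorem tau_C_inv_mul_C_sub_mem_negA (x y : W) :
    tau L (C L x⁻¹ * C L y) - (if x = y then 1 else 0) ∈ negA Γ := by
  -- The Kronecker delta is spread over `w` so that it can be subtracted term by term from the
  -- expansion of `τ`.
  have e : (if x = y then 1 else 0 : AddMonoidAlgebra ℤ Γ) =
      ∑ w, if x⁻¹ = w ∧ y = w⁻¹ then 1 else 0 := by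
    rw [Finset.sum_eq_single x⁻¹]
    · simp [eq_comm]
    · intro b _ hb; rw [if_neg]; rintro ⟨rfl, -⟩; exact hb rfl
    · simp
  rw [tau_mul, e, ← Finset.sum_sub_distrib]
  exact sum_mem fun w _ =>
    mul_sub_ite_mem_negA (repr_C_sub_mem_negA L _ _) (repr_C_sub_mem_negA L _ _)

end Fin

section Longest

set_option linter.unusedSectionVars false

variable {L} {w₀ : W} (hw₀ : ∀ x : W, cs.length x ≤ cs.length w₀)
include hw₀

/-! ### Conjugation by the longest element -/

theorem T_longest_mul_bar : T L w₀ * bar L (T L w₀) = 1 := by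
  rw [bar_T, CoxeterSystem.longest_inv hw₀]
  exact Units.mul_inv (TUnit L w₀)

theorem bar_mul_T_longest : bar L (T L w₀) * T L w₀ = 1 := by
  rw [bar_T, CoxeterSystem.longest_inv hw₀]
  exact Units.inv_mul (TUnit L w₀)

theorem bar_bar_T_longest : bar L (bar L (T L w₀)) = T L w₀ := by
  refine (left_inv_eq_right_inv (T_longest_mul_bar hw₀) ?_).symm
  rw [← bar_mul, T_longest_mul_bar hw₀, bar_one]

/-- Both `(w₀w⁻¹) · w` and `(w₀ww₀) · (w₀w⁻¹)` are length-additive factorizations of `w₀`. -/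
theorem T_longest_mul_T (w : W) : T L w₀ * T L w = T L (w₀ * w * w₀) * T L w₀ := by
  have h0 := CoxeterSystem.longest_mul_self hw₀
  have h1 := CoxeterSystem.length_longest_mul_inv hw₀ w
  have h2 := CoxeterSystem.length_longest_conj hw₀ w
  have e1 : T L (w₀ * w⁻¹) * T L w = T L w₀ := by
    rw [T_mul_T L (by rw [inv_mul_cancel_right]; exact h1.symm), inv_mul_cancel_right]
  have e3 : w₀ * w * w₀ * (w₀ * w⁻¹) = w₀ := by
    rw [mul_assoc _ w₀, ← mul_assoc w₀ w₀, h0, one_mul, mul_inv_cancel_right]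
  have e2 : T L (w₀ * w * w₀) * T L (w₀ * w⁻¹) = T L w₀ := by
    rw [T_mul_T L (by rw [e3]; omega), e3]
  rw [← e1, ← mul_assoc (T L (w₀ * w * w₀)), e2, e1]

theorem longest_conj_conj (w : W) : w₀ * (w₀ * w * w₀) * w₀ = w := by
  have h0 := CoxeterSystem.longest_mul_self hw₀
  rw [mul_assoc w₀ w, ← mul_assoc w₀ w₀, h0, one_mul, mul_assoc, h0, mul_one]

theorem longest_mul_cancel (w : W) : w₀ * (w₀ * w) = w := by
  rw [← mul_assoc, CoxeterSystem.longest_mul_self hw₀, one_mul]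

theorem mul_longest_cancel (w : W) : w * w₀ * w₀ = w := by
  rw [mul_assoc, CoxeterSystem.longest_mul_self hw₀, mul_one]

theorem T_longest_sq_mul (x : HeckeAlgebra L) :
    T L w₀ * T L w₀ * x = x * (T L w₀ * T L w₀) := by
  induction x using basis_induction (T L) with
  | basis w =>
    rw [mul_assoc, T_longest_mul_T hw₀, ← mul_assoc, T_longest_mul_T hw₀, longest_conj_conj hw₀,
      mul_assoc]
  | add x y hx hy => rw [mul_add, hx, hy, add_mul]
  | smul a x hx => rw [mul_smul_comm, hx, smul_mul_assoc]

theorem repr_longest_conj (x : HeckeAlgebra L) (w : W) :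
    (T L).repr (T L w₀ * x * bar L (T L w₀)) w = (T L).repr x (w₀ * w * w₀) := by
  classical
  induction x using basis_induction (T L) with
  | basis y =>
    rw [T_longest_mul_T hw₀, mul_assoc, T_longest_mul_bar hw₀, mul_one, Module.Basis.repr_self,
      Module.Basis.repr_self, Finsupp.single_apply, Finsupp.single_apply]
    refine if_congr ⟨?_, ?_⟩ rfl rfl
    · rintro rfl; rw [longest_conj_conj hw₀]
    · rintro rfl; rw [longest_conj_conj hw₀]
  | add x y hx hy => simp [mul_add, add_mul, hx, hy]
  | smul a x hx => simp [hx]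

/-- Conjugation by `T_{w₀}` permutes the standard basis, so triangularity is kept. Bar turns it into
conjugation by `T_{w₀}⁻¹`, which is the same map because `T_{w₀}²` is central. -/
theorem longest_conj_C (w : W) : T L w₀ * C L w * bar L (T L w₀) = C L (w₀ * w * w₀) := by
  refine IsKL.eq_C ⟨?_, fun y => ?_⟩
  · rw [bar_mul, bar_mul, bar_C, bar_bar_T_longest hw₀]
    calc bar L (T L w₀) * C L w * T L w₀
        = bar L (T L w₀) * (C L w * (T L w₀ * T L w₀)) * bar L (T L w₀) := by
          simp only [mul_assoc, T_longest_mul_bar hw₀, mul_one]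
      _ = T L w₀ * C L w * bar L (T L w₀) := by
          rw [← T_longest_sq_mul hw₀]
          simp only [← mul_assoc, bar_mul_T_longest hw₀, one_mul]
  · have e : T L (w₀ * w * w₀) = T L w₀ * T L w * bar L (T L w₀) := by
      rw [T_longest_mul_T hw₀, mul_assoc _ (T L w₀), T_longest_mul_bar hw₀, mul_one]
    rw [e, ← sub_mul, ← mul_sub, repr_longest_conj hw₀]
    exact (isKL_C L w).2 _

theorem T_longest_mul_C (w : W) : T L w₀ * C L w = C L (w₀ * w * w₀) * T L w₀ := by
  rw [← longest_conj_C hw₀, mul_assoc, bar_mul_T_longest hw₀, mul_one]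

theorem C_repr_longest_conj (x : HeckeAlgebra L) (w : W) :
    (C L).repr (T L w₀ * x * bar L (T L w₀)) (w₀ * w * w₀) = (C L).repr x w := by
  classical
  induction x using basis_induction (C L) with
  | basis y =>
    rw [longest_conj_C hw₀, Module.Basis.repr_self,
      Module.Basis.repr_self, Finsupp.single_apply, Finsupp.single_apply]
    simp
  | add x y hx hy => simp [mul_add, add_mul, hx, hy]
  | smul a x hx => simp [hx]

theorem h_longest_conj (x y z : W) :
    h L (w₀ * x * w₀) (w₀ * y * w₀) (w₀ * z * w₀) = h L x y z := by
  rw [h, h, ← C_repr_longest_conj hw₀ (C L x * C L y), ← longest_conj_C hw₀ x,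
    ← longest_conj_C hw₀ y]
  congr 2
  simp only [mul_assoc]
  rw [← mul_assoc (bar L (T L w₀)) (T L w₀), bar_mul_T_longest hw₀, one_mul]

theorem tau_longest_conj (z : W) : tau L (C L (w₀ * z * w₀)) = tau L (C L z) := by
  rw [← longest_conj_C hw₀, tau_mul_comm, ← mul_assoc, bar_mul_T_longest hw₀, one_mul]

theorem Delta_longest_conj (z : W) : Delta L (w₀ * z * w₀) = Delta L z := by
  rw [Delta, Delta, tau_longest_conj hw₀]

theorem a_longest_conj [Fintype W] (z : W) : a L (w₀ * z * w₀) = a L z := by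
  apply le_antisymm
  · refine a_le_a L fun x y => ⟨w₀ * x * w₀, w₀ * y * w₀, ?_⟩
    rw [← h_longest_conj hw₀, longest_conj_conj hw₀]
  · exact a_le_a L fun x y => ⟨w₀ * x * w₀, w₀ * y * w₀, (h_longest_conj hw₀ x y z).symm⟩

theorem longest_conj_mem_D [Fintype W] {z : W} : w₀ * z * w₀ ∈ D L ↔ z ∈ D L := by
  simp only [D, Set.mem_ofPred_eq, a_longest_conj hw₀, Delta_longest_conj hw₀]

end Longest

end

end Hecke

namespace Hecke

/-! ### Preorders, the dual basis and their behaviour under `w₀`. -/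

section

variable {B : Type*} {M : CoxeterMatrix B} {W : Type*} [Group W] {cs : CoxeterSystem M W}
  {Γ : Type*} [AddCommGroup Γ] [LinearOrder Γ] [IsOrderedAddMonoid Γ] (L : WeightFunction cs Γ)

/-! ### Left multiplication and the left preorder -/

/-- `T_s` and `C_s` differ by a scalar, which affects only the coefficient of `C_y` itself. -/
theorem leftLE_of_T_simple_mul {i : B} {y z u : W} (hy : LeftLE L y u)
    (hz : (C L).repr (T L (cs.simple i) * C L y) z ≠ 0) : LeftLE L z u := by
  classical
  by_cases hzy : y = z
  · rwa [← hzy]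
  · refine Relation.ReflTransGen.head ⟨i, ?_⟩ hy
    rw [C_simple, add_mul, map_add, Finsupp.add_apply, smul_mul_assoc, one_mul, map_smul,
      Finsupp.smul_apply, Module.Basis.repr_self, Finsupp.single_apply, if_neg hzy, smul_zero,
      add_zero]
    exact hz

/-- The `C_z` with `z ≤_L u` span a left ideal, being stable under each `T_s`. -/
theorem leftLE_of_repr_mul_ne_zero (x : HeckeAlgebra L) {u z : W}
    (h : (C L).repr (x * C L u) z ≠ 0) : LeftLE L z u := by
  induction x using generator_induction generalizing z with
  | one =>
    classical
    rw [one_mul, Module.Basis.repr_self, Finsupp.single_apply] at h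
    have : u = z := by by_contra h'; exact h (if_neg h')
    rw [this]; exact Relation.ReflTransGen.refl
  | simple_mul i x hx =>
    rw [mul_assoc, ← (C L).linearCombination_repr (x * C L u), Finsupp.linearCombination_apply,
      Finsupp.sum, Finset.mul_sum, map_sum, Finsupp.finsetSum_apply] at h
    obtain ⟨y, hy, hne⟩ := Finset.exists_ne_zero_of_sum_ne_zero h
    rw [mul_smul_comm, map_smul, Finsupp.smul_apply] at hne
    exact leftLE_of_T_simple_mul L (hx (Finsupp.mem_support_iff.1 hy)) (right_ne_zero_of_smul hne)
  | add x y hx hy =>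
    rw [add_mul, map_add, Finsupp.add_apply] at h
    by_cases h' : (C L).repr (x * C L u) z = 0
    · rw [h', zero_add] at h; exact hy h
    · exact hx h'
  | smul a x hx =>
    rw [smul_mul_assoc, map_smul, Finsupp.smul_apply] at h
    exact hx (right_ne_zero_of_smul h)

theorem leftLE_of_h_ne_zero {x y z : W} (h0 : h L x y z ≠ 0) : LeftLE L z y :=
  leftLE_of_repr_mul_ne_zero L _ h0

variable {L}

theorem LeftLE.twoSidedLE {x y : W} (hxy : LeftLE L x y) : TwoSidedLE L x y :=
  Relation.ReflTransGen.mono (fun _ _ h => Or.inl h) _ _ hxy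

theorem leftArrow_inv_iff {x y : W} : LeftArrow L x⁻¹ y⁻¹ ↔ RightArrow L x y := by
  refine exists_congr fun i => ?_
  rw [← C_repr_flat, flat_mul, flat_C, flat_C, inv_inv, cs.inv_simple]

theorem TwoSidedLE.inv {x y : W} (hxy : TwoSidedLE L x y) : TwoSidedLE L x⁻¹ y⁻¹ := by
  refine hxy.lift (fun z => z⁻¹) fun u w h => ?_
  rcases h with h | h
  · exact Or.inr (leftArrow_inv_iff.1 (by rwa [inv_inv, inv_inv]))
  · exact Or.inl (leftArrow_inv_iff.2 h)

theorem LeftEquiv.symm {x y : W} (hxy : LeftEquiv L x y) : LeftEquiv L y x := ⟨hxy.2, hxy.1⟩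

theorem LeftEquiv.trans {x y z : W} (hxy : LeftEquiv L x y) (hyz : LeftEquiv L y z) :
    LeftEquiv L x z := ⟨hxy.1.trans hyz.1, hyz.2.trans hxy.2⟩

theorem LeftEquiv.refl (x : W) : LeftEquiv L x x :=
  ⟨Relation.ReflTransGen.refl, Relation.ReflTransGen.refl⟩

section Longest

set_option linter.unusedSectionVars false

variable {w₀ : W} (hw₀ : ∀ x : W, cs.length x ≤ cs.length w₀)
include hw₀

/-! ### Duality -/

/-- `T_{w₀}` factors as `T_{u⁻¹} T_{uw₀}`, and `bar T_u` is the inverse of the first factor. -/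
theorem dag_T_mul_T_longest (u : W) :
    dag L (T L u) * T L w₀ = sgn L u • T L (u * w₀) := by
  have h1 : T L u⁻¹ * T L (u * w₀) = T L w₀ := by
    have := CoxeterSystem.length_mul_longest hw₀ u
    rw [T_mul_T L (by rw [inv_mul_cancel_left, cs.length_inv]; omega), inv_mul_cancel_left]
  have h2 : bar L (T L u) * T L u⁻¹ = 1 := by
    rw [bar_T]; exact Units.inv_mul (TUnit L u⁻¹)
  rw [dag_T, smul_mul_assoc, ← h1, ← mul_assoc, h2, one_mul]

theorem repr_dag_mul_T_longest (x : HeckeAlgebra L) (y : W) :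
    (T L).repr (dag L x * T L w₀) y = sgn L (y * w₀) * (T L).repr x (y * w₀) := by
  classical
  induction x using basis_induction (T L) with
  | basis u =>
    rw [dag_T_mul_T_longest hw₀, map_smul, Finsupp.smul_apply, Module.Basis.repr_self,
      Module.Basis.repr_self, Finsupp.single_apply, Finsupp.single_apply, smul_eq_mul]
    by_cases h : u = y * w₀
    · rw [if_pos h, if_pos (by rw [h, mul_longest_cancel hw₀]), h]
    · rw [if_neg h, if_neg, mul_zero, mul_zero]
      rintro rfl
      exact h (mul_longest_cancel hw₀ u).symm
  | add x y hx hy => simp [add_mul, mul_add, hx, hy]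
  | smul a x hx =>
    simp only [map_smul, smul_mul_assoc, Finsupp.smul_apply, hx, smul_eq_mul]
    ring

/-- Allows `repr_bar` to be applied at `w₀` to any element: bar conjugates the coefficient of
`T_{w₀}`. -/
theorem mem_below_longest (x : HeckeAlgebra L) : x ∈ below L (cs.length w₀ + 1) := by
  induction x using basis_induction (T L) with
  | basis w => exact T_mem_below L (Nat.lt_succ_of_le (hw₀ w))
  | add x y hx hy => exact add_mem hx hy
  | smul a x hx => exact Submodule.smul_mem _ _ hx

variable [Fintype W]

open Classical in
/-- The basis dual to `(C_x)` with respect to `τ` is, up to signs, `(C_z† T_{w₀})`. -/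
theorem tau_C_mul_dag_C_mul_T_longest (x z : W) :
    tau L (C L x * dag L (C L z) * T L w₀) = if z = x⁻¹ * w₀ then sgn L z else 0 := by
  -- The trace is the `T_{w₀}`-coefficient of the bar-invariant element `C_x C_z†`, hence is itself
  -- bar-invariant. A bar-invariant element of `A_{<0}` is zero, so it is enough to know the trace
  -- modulo `A_{<0}`.
  have hbar : barA (tau L (C L x * dag L (C L z) * T L w₀)) =
      tau L (C L x * dag L (C L z) * T L w₀) := by
    rw [tau_mul_T, CoxeterSystem.longest_inv hw₀, ← repr_bar L (mem_below_longest hw₀ _), bar_mul,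
      ← dag_bar, bar_C, bar_C]
  refine sub_eq_zero.1 (eq_zero_of_barA_eq ?_ ?_)
  · rw [map_sub, hbar, apply_ite barA, barA_sgn, map_zero]
  · have e : (if z = x⁻¹ * w₀ then sgn L z else 0) =
        ∑ w, sgn L (w⁻¹ * w₀) * (if x = w ∧ z = w⁻¹ * w₀ then 1 else 0) := by
      rw [Finset.sum_eq_single x]
      · simp only [true_and, mul_ite, mul_one, mul_zero]
        split_ifs with h
        · rw [h]
        · rfl
      · intro b _ hb; rw [if_neg, mul_zero]; rintro ⟨rfl, -⟩; exact hb rfl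
      · simp
    rw [mul_assoc, tau_mul, e, ← Finset.sum_sub_distrib]
    refine sum_mem fun w _ => ?_
    rw [repr_dag_mul_T_longest hw₀, mul_left_comm, ← mul_sub]
    have := mul_sub_ite_mem_negA (repr_C_sub_mem_negA L x w)
      (repr_C_sub_mem_negA L z (w⁻¹ * w₀))
    rcases sgn_eq_or L (w⁻¹ * w₀) with h | h <;> rw [h]
    · rwa [one_mul]
    · rw [neg_one_mul]; exact neg_mem this

theorem C_repr_eq_tau (x : HeckeAlgebra L) (z : W) : (C L).repr x z =
    sgn L (z⁻¹ * w₀) * tau L (x * dag L (C L (z⁻¹ * w₀)) * T L w₀) := by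
  classical
  induction x using basis_induction (C L) with
  | basis y =>
    rw [tau_C_mul_dag_C_mul_T_longest hw₀, Module.Basis.repr_self, Finsupp.single_apply]
    by_cases h : y = z
    · rw [if_pos h, if_pos (by rw [h]), sgn_mul_self]
    · rw [if_neg h, if_neg (fun e => h (inv_injective (mul_right_cancel e)).symm), mul_zero]
  | add x y hx hy => simp [add_mul, mul_add, hx, hy]
  | smul a x hx =>
    simp only [map_smul, smul_mul_assoc, Finsupp.smul_apply, hx, smul_eq_mul]
    ring

/-- The same dual pairing as in `C_repr_eq_tau`, with `x` now placed in the slot under `dag`. -/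
theorem C_repr_eq_tau_dag (x : HeckeAlgebra L) (z : W) : (C L).repr x z =
    sgn L z * tau L (C L (w₀ * z⁻¹) * dag L x * T L w₀) := by
  classical
  induction x using basis_induction (C L) with
  | basis y =>
    rw [tau_C_mul_dag_C_mul_T_longest hw₀, Module.Basis.repr_self, Finsupp.single_apply,
      mul_inv_rev, inv_inv, CoxeterSystem.longest_inv hw₀, mul_longest_cancel hw₀]
    by_cases h : y = z
    · rw [if_pos h, if_pos h, h, sgn_mul_self]
    · rw [if_neg h, if_neg h, mul_zero]
  | add x y hx hy => simp [add_mul, mul_add, hx, hy]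
  | smul a x hx =>
    simp only [map_smul, smul_mul_assoc, mul_smul_comm, Finsupp.smul_apply, hx, smul_eq_mul]
    ring

theorem tau_C_mul_dag (x : HeckeAlgebra L) (y : W) :
    tau L (C L y * dag L x * T L w₀) = sgn L (y⁻¹ * w₀) * (C L).repr x (y⁻¹ * w₀) := by
  rw [C_repr_eq_tau_dag hw₀, ← mul_assoc, sgn_mul_self, one_mul, mul_inv_rev, inv_inv,
    CoxeterSystem.longest_inv hw₀, longest_mul_cancel hw₀]

/-! ### Multiplication by the longest element reverses the preorders -/

omit [Fintype W] hw₀ in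
theorem eq_or_of_repr_smul_sub_ne_zero {b : AddMonoidAlgebra ℤ Γ} {x : HeckeAlgebra L} {u z : W}
    (h : (C L).repr (b • C L u - x) z ≠ 0) : u = z ∨ (C L).repr x z ≠ 0 := by
  classical
  by_contra! h'
  apply h
  rw [map_sub, Finsupp.sub_apply, h'.2, map_smul, Finsupp.smul_apply, Module.Basis.repr_self,
    Finsupp.single_apply, if_neg h'.1, smul_zero, sub_zero]

/-- By cyclicity of `τ`, the factor `C_s` moves to the far right and then across `T_{w₀}`, becoming
`C_{s'}` with `s' = w₀sw₀`. Absorbed under `dag` it is a scalar minus `C_{s'}`; the scalar accounts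
for the alternative `x = y`, the other term gives the reversed arrow after applying `flat`. -/
theorem LeftArrow.longest_mul {x y : W} (hxy : LeftArrow L x y) :
    x = y ∨ LeftArrow L (w₀ * y) (w₀ * x) := by
  obtain ⟨i, hi⟩ := hxy
  obtain ⟨j, hj⟩ := CoxeterSystem.exists_longest_conj_simple hw₀ i
  have e : tau L (C L (cs.simple i) * C L y * dag L (C L (x⁻¹ * w₀)) * T L w₀) =
      tau L (C L y * dag L (C L (x⁻¹ * w₀) * dag L (C L (cs.simple j))) * T L w₀) := by
    rw [dag_mul, dag_dag, mul_assoc, mul_assoc, tau_mul_comm, mul_assoc, mul_assoc,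
      T_longest_mul_C hw₀, hj]
    simp only [mul_assoc]
  rw [C_repr_eq_tau hw₀, e, tau_C_mul_dag hw₀] at hi
  have h1 := right_ne_zero_of_mul (right_ne_zero_of_mul hi)
  rw [dag_C_simple, mul_sub, mul_smul_comm, mul_one] at h1
  rcases eq_or_of_repr_smul_sub_ne_zero h1 with h2 | h2
  · exact Or.inl (inv_injective (mul_right_cancel h2))
  · refine Or.inr ⟨j, ?_⟩
    rwa [← inv_inv (w₀ * y), ← C_repr_flat, flat_mul, flat_C, flat_C, mul_inv_rev, mul_inv_rev,
      CoxeterSystem.longest_inv hw₀, cs.inv_simple]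

/-- Here `C_s` is already adjacent to the factor under `dag`, so neither cyclicity nor conjugation
by `w₀` is needed. -/
theorem RightArrow.longest_mul {x y : W} (hxy : RightArrow L x y) :
    x = y ∨ RightArrow L (w₀ * y) (w₀ * x) := by
  obtain ⟨i, hi⟩ := hxy
  have e : tau L (C L y * C L (cs.simple i) * dag L (C L (x⁻¹ * w₀)) * T L w₀) =
      tau L (C L y * dag L (dag L (C L (cs.simple i)) * C L (x⁻¹ * w₀)) * T L w₀) := by
    rw [dag_mul, dag_dag]
    simp only [mul_assoc]
  rw [C_repr_eq_tau hw₀, e, tau_C_mul_dag hw₀] at hi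
  have h1 := right_ne_zero_of_mul (right_ne_zero_of_mul hi)
  rw [dag_C_simple, sub_mul, smul_mul_assoc, one_mul] at h1
  rcases eq_or_of_repr_smul_sub_ne_zero h1 with h2 | h2
  · exact Or.inl (inv_injective (mul_right_cancel h2))
  · refine Or.inr (leftArrow_inv_iff.1 ⟨i, ?_⟩)
    rwa [mul_inv_rev, mul_inv_rev, CoxeterSystem.longest_inv hw₀]

theorem LeftLE.longest_mul {x y : W} (hxy : LeftLE L x y) : LeftLE L (w₀ * y) (w₀ * x) := by
  induction hxy with
  | refl => exact Relation.ReflTransGen.refl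
  | tail _ h ih =>
    rcases LeftArrow.longest_mul hw₀ h with rfl | h
    · exact ih
    · exact ih.head h

theorem TwoSidedLE.longest_mul {x y : W} (hxy : TwoSidedLE L x y) :
    TwoSidedLE L (w₀ * y) (w₀ * x) := by
  induction hxy with
  | refl => exact Relation.ReflTransGen.refl
  | tail _ h ih =>
    rcases h with h | h
    · rcases LeftArrow.longest_mul hw₀ h with rfl | h
      · exact ih
      · exact ih.head (Or.inl h)
    · rcases RightArrow.longest_mul hw₀ h with rfl | h
      · exact ih
      · exact ih.head (Or.inr h)

theorem LeftEquiv.longest_mul {x y : W} (hxy : LeftEquiv L x y) :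
    LeftEquiv L (w₀ * x) (w₀ * y) :=
  ⟨LeftLE.longest_mul hw₀ hxy.2, LeftLE.longest_mul hw₀ hxy.1⟩

end Longest

end

end Hecke

namespace Hecke

/-! ### Leading coefficients of `T_{w₀}⁻¹` on the Kazhdan–Lusztig basis. -/

section

set_option linter.unusedSectionVars false

variable {B : Type*} {M : CoxeterMatrix B} {W : Type*} [Group W] {cs : CoxeterSystem M W}
  {Γ : Type*} [AddCommGroup Γ] [LinearOrder Γ] [IsOrderedAddMonoid Γ] {L : WeightFunction cs Γ}
  [Fintype W]

theorem P1.deg_tau_C_le (hP1 : P1 L) (z : W) :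
    deg (tau L (C L z)) ≤ ((-a L z : Γ) : WithBot Γ) := by
  have := hP1 z
  rw [Delta] at this
  revert this
  generalize deg (tau L (C L z)) = d
  cases d with
  | bot => simp
  | coe γ =>
    intro h
    have h' : a L z ≤ -γ := WithTop.coe_le_coe.1 h
    exact WithBot.coe_le_coe.2 (le_neg.1 h')

/-- Since P₁ bounds the degree of `τ(C_z)`, membership in `𝒟` becomes nonvanishing of one
coefficient. If `τ(C_z) = 0`, then `Δ(z) = ⊤` and both sides fail. -/
theorem P1.mem_D_iff (hP1 : P1 L) (z : W) :
    z ∈ D L ↔ (tau L (C L z)).coeff (-a L z) ≠ 0 := by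
  rw [← deg_eq_iff (hP1.deg_tau_C_le z), D, Set.mem_ofPred_eq, Delta]
  generalize deg (tau L (C L z)) = d
  cases d with
  | bot => simp
  | coe γ =>
    refine WithTop.coe_eq_coe.trans (Iff.trans ?_ WithBot.coe_eq_coe.symm)
    rw [eq_neg_iff_add_eq_zero, eq_neg_iff_add_eq_zero, add_comm]

theorem P4.a_eq_of_leftEquiv (hP4 : P4 L) {x y : W} (hxy : LeftEquiv L x y) : a L x = a L y :=
  le_antisymm (hP4 _ _ hxy.2.twoSidedLE) (hP4 _ _ hxy.1.twoSidedLE)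

theorem deg_tau_C_inv_mul_C_le (x y : W) :
    deg (tau L (C L x⁻¹ * C L y)) ≤ ((0 : Γ) : WithBot Γ) := by
  classical
  have h := tau_C_inv_mul_C_sub_mem_negA L x y
  rw [deg_le_iff]
  intro γ hγ
  by_contra! hlt
  refine absurd (h γ ?_) hlt.asymm
  rw [AddMonoidAlgebra.coeff_sub, Finsupp.sub_apply]
  split_ifs
  · rw [AddMonoidAlgebra.one_def, AddMonoidAlgebra.coeff_single, Finsupp.single_apply,
      if_neg hlt.ne, sub_zero]
    exact hγ
  · simpa using hγ

open Classical in
theorem coeff_tau_C_inv_mul_C (x y : W) :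
    (tau L (C L x⁻¹ * C L y)).coeff 0 = if x = y then 1 else 0 := by
  have h := coeff_zero_of_mem_negA (tau_C_inv_mul_C_sub_mem_negA L x y)
  rw [AddMonoidAlgebra.coeff_sub, Finsupp.sub_apply, sub_eq_zero] at h
  rw [h]
  split_ifs
  · rw [AddMonoidAlgebra.one_def, AddMonoidAlgebra.coeff_single, Finsupp.single_eq_same]
  · simp

variable (L) in
/-- The coefficient of `C_x` in `T_{w₀}⁻¹ C_y`. -/
noncomputable def lam (w₀ x y : W) : AddMonoidAlgebra ℤ Γ :=
  (C L).repr (bar L (T L w₀) * C L y) x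

variable (L) in
/-- The difference `a(w₀ y) - a(y)`. -/
noncomputable def shift (w₀ y : W) : Γ := a L (w₀ * y) - a L y

variable (L) in
/-- The coefficient of `v ^ (a(w₀ y) - a(y))` in `lam L w₀ x y`. -/
noncomputable def lead (w₀ x y : W) : ℤ := (lam L w₀ x y).coeff (shift L w₀ y)

theorem bar_T_mul_C (w₀ y : W) : bar L (T L w₀) * C L y = ∑ x, lam L w₀ x y • C L x :=
  ((C L).sum_repr _).symm

theorem leftLE_of_lam_ne_zero {w₀ x y : W} (h : lam L w₀ x y ≠ 0) : LeftLE L x y :=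
  leftLE_of_repr_mul_ne_zero L _ h

variable {w₀ : W} (hw₀ : ∀ x : W, cs.length x ≤ cs.length w₀)
include hw₀

theorem lam_eq_sgn_mul_tau (x y : W) :
    lam L w₀ x y = sgn L (x⁻¹ * w₀) * tau L (C L y * dag L (C L (x⁻¹ * w₀))) := by
  rw [lam, C_repr_eq_tau hw₀, tau_mul_comm, ← mul_assoc, ← mul_assoc, T_longest_mul_bar hw₀, one_mul]

/-- Inserting `T_{w₀}⁻¹ T_{w₀}` brings the trace to the form of `tau_C_mul_dag`, so it is a
coefficient of `C_{x⁻¹w₀} · (T_{w₀}⁻¹)†`. Expanding the last factor in the basis `C` produces the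
values `τ(C_{w₀z})`. -/
theorem lam_eq_sum (x y : W) : lam L w₀ x y = sgn L (x⁻¹ * w₀) * (sgn L (y⁻¹ * w₀) *
    ∑ z, sgn L z * (tau L (C L (w₀ * z)) * h L z (w₀ * x) (w₀ * y))) := by
  have e1 : C L y * dag L (C L (x⁻¹ * w₀)) =
      C L y * dag L (C L (x⁻¹ * w₀) * dag L (bar L (T L w₀))) * T L w₀ := by
    rw [dag_mul, dag_dag, mul_assoc, mul_assoc, bar_mul_T_longest hw₀, mul_one]
  have e2 : ∀ z, (C L).repr (dag L (bar L (T L w₀))) z⁻¹ = sgn L z * tau L (C L (w₀ * z)) := by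
    intro z
    rw [C_repr_eq_tau_dag hw₀, dag_dag, mul_assoc, bar_mul_T_longest hw₀, mul_one, inv_inv, sgn_inv]
  rw [lam_eq_sgn_mul_tau hw₀, e1, tau_C_mul_dag hw₀]
  congr 2
  rw [← (C L).sum_repr (dag L (bar L (T L w₀))), Finset.mul_sum, map_sum,
    Finsupp.finsetSum_apply, ← Equiv.sum_comp (Equiv.inv W)]
  refine Finset.sum_congr rfl fun z _ => ?_
  rw [Equiv.inv_apply, e2, mul_smul_comm, map_smul, Finsupp.smul_apply, ← h_inv L (w₀ * x),
    mul_inv_rev, mul_inv_rev, CoxeterSystem.longest_inv hw₀, h, smul_eq_mul, mul_assoc]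

theorem C_repr_T_longest_mul_C (x y : W) :
    (C L).repr (T L w₀ * C L y) x = barA (lam L w₀ x y) := by
  rw [lam, ← C_repr_bar, bar_mul, bar_bar_T_longest hw₀, bar_C]

theorem flat_T_longest : flat L (T L w₀) = T L w₀ := by
  rw [flat_T, CoxeterSystem.longest_inv hw₀]

/-- Bar replaces `T_{w₀}⁻¹` by `T_{w₀}`. In the dual pairing `T_{w₀}†` is `±T_{w₀}⁻¹` and cancels
the `T_{w₀}` there, leaving the trace that defines the transposed entry at `w₀y, w₀x`. -/
theorem barA_lam (x y : W) : barA (lam L w₀ x y) =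
    sgn L x * (sgn L w₀ * (sgn L y * lam L w₀ (w₀ * y) (w₀ * x))) := by
  rw [← C_repr_T_longest_mul_C hw₀, ← inv_inv x, ← C_repr_flat, flat_mul, flat_C,
    flat_T_longest hw₀, C_repr_eq_tau_dag hw₀, dag_mul, dag_T, mul_assoc, mul_assoc,
    smul_mul_assoc, bar_mul_T_longest hw₀, lam_eq_sgn_mul_tau hw₀, inv_inv, sgn_inv, mul_inv_rev,
    mul_assoc, CoxeterSystem.longest_inv hw₀, CoxeterSystem.longest_mul_self hw₀, mul_one,
    mul_smul_comm, mul_smul_comm, mul_one, map_smul, smul_eq_mul, sgn_inv, ← mul_assoc (sgn L y),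
    sgn_mul_self, one_mul]

theorem P4.shift_eq_of_leftEquiv (hP4 : P4 L) {x y : W} (hxy : LeftEquiv L x y) :
    shift L w₀ x = shift L w₀ y := by
  rw [shift, shift, hP4.a_eq_of_leftEquiv hxy,
    hP4.a_eq_of_leftEquiv (LeftEquiv.longest_mul hw₀ hxy)]

theorem P4.shift_le_of_leftLE (hP4 : P4 L) {x y : W} (hxy : LeftLE L x y) :
    shift L w₀ x ≤ shift L w₀ y :=
  sub_le_sub (hP4 _ _ (LeftLE.longest_mul hw₀ hxy).twoSidedLE) (hP4 _ _ hxy.twoSidedLE)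

/-- The nonzero structure constant gives `w₀y ≤_LR z` after passing to inverses; multiplying by `w₀`
reverses this to `w₀z ≤_LR y`, and P₄ applies. -/
theorem P4.a_le_of_h_ne_zero (hP4 : P4 L) {x y z : W} (h0 : h L z (w₀ * x) (w₀ * y) ≠ 0) :
    a L y ≤ a L (w₀ * z) := by
  rw [← h_inv] at h0
  have h1 := TwoSidedLE.longest_mul hw₀ (leftLE_of_h_ne_zero L h0).twoSidedLE.inv
  rw [inv_inv, inv_inv, longest_mul_cancel hw₀] at h1
  exact hP4 _ _ h1

theorem P1.deg_tau_C_mul_h_le (hP1 : P1 L) (hP4 : P4 L) (x y z : W) :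
    deg (tau L (C L (w₀ * z)) * h L z (w₀ * x) (w₀ * y)) ≤
      ((shift L w₀ y : Γ) : WithBot Γ) := by
  by_cases h0 : h L z (w₀ * x) (w₀ * y) = 0
  · rw [h0, mul_zero, deg_zero]; exact bot_le
  · refine (deg_mul_le (hP1.deg_tau_C_le _) (deg_h_le L _ _ _)).trans (WithBot.coe_le_coe.2 ?_)
    rw [shift, neg_add_eq_sub]
    exact sub_le_sub_left (hP4.a_le_of_h_ne_zero hw₀ h0) _

theorem P1.coeff_tau_C_mul_h (hP1 : P1 L) (hP4 : P4 L) (x y z : W) :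
    (tau L (C L (w₀ * z)) * h L z (w₀ * x) (w₀ * y)).coeff (shift L w₀ y) =
      (tau L (C L (w₀ * z))).coeff (-a L y) * gam L z (w₀ * x) (w₀ * y)⁻¹ := by
  rw [gam, inv_inv]
  by_cases h0 : h L z (w₀ * x) (w₀ * y) = 0
  · simp [h0]
  -- The weaker bound `-a(y)`, uniform in `z`, is used so that it adds up with `a(w₀y)` to the shift
  -- of `y`.
  · have h1 : deg (tau L (C L (w₀ * z))) ≤ ((-a L y : Γ) : WithBot Γ) :=
      (hP1.deg_tau_C_le _).trans
        (WithBot.coe_le_coe.2 (neg_le_neg (hP4.a_le_of_h_ne_zero hw₀ h0)))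
    rw [← coeff_mul_of_deg_le h1 (deg_h_le L _ _ _), shift, neg_add_eq_sub]

theorem P1.deg_lam_le (hP1 : P1 L) (hP4 : P4 L) (x y : W) :
    deg (lam L w₀ x y) ≤ ((shift L w₀ y : Γ) : WithBot Γ) := by
  rw [lam_eq_sum hw₀, deg_sgn_mul, deg_sgn_mul]
  refine deg_sum_le fun z _ => ?_
  rw [deg_sgn_mul]
  exact hP1.deg_tau_C_mul_h_le hw₀ hP4 x y z

theorem P1.lead_eq_sum (hP1 : P1 L) (hP4 : P4 L) (x y : W) :
    lead L w₀ x y = (-1) ^ cs.length (x⁻¹ * w₀) * ((-1) ^ cs.length (y⁻¹ * w₀) *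
      ∑ z, (-1) ^ cs.length z *
        ((tau L (C L (w₀ * z))).coeff (-a L y) * gam L z (w₀ * x) (w₀ * y)⁻¹)) := by
  rw [lead, lam_eq_sum hw₀, coeff_sgn_mul, coeff_sgn_mul, AddMonoidAlgebra.coeff_sum,
    Finsupp.finsetSum_apply]
  simp only [coeff_sgn_mul, hP1.coeff_tau_C_mul_h hw₀ hP4]

theorem P8.leftEquiv_of_lead_ne_zero (hP1 : P1 L) (hP4 : P4 L) (hP8 : P8 L) {x y : W}
    (h0 : lead L w₀ x y ≠ 0) : LeftEquiv L x y := by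
  rw [hP1.lead_eq_sum hw₀ hP4] at h0
  obtain ⟨z, -, hz⟩ := Finset.exists_ne_zero_of_sum_ne_zero
    (right_ne_zero_of_mul (right_ne_zero_of_mul h0))
  have h1 := (hP8 _ _ _ (right_ne_zero_of_mul (right_ne_zero_of_mul hz))).2.1
  rw [inv_inv] at h1
  have := LeftEquiv.longest_mul hw₀ h1
  rwa [longest_mul_cancel hw₀, longest_mul_cancel hw₀] at this

/-- By `barA_lam`, the bar conjugate has degree at most the shift of `w₀x`, which is minus the shift
of `x`, hence of `y`. The upper and lower bounds on the exponents therefore coincide. -/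
theorem P1.lam_eq_single (hP1 : P1 L) (hP4 : P4 L) {x y : W} (hxy : LeftEquiv L x y) :
    lam L w₀ x y = AddMonoidAlgebra.single (shift L w₀ y) (lead L w₀ x y) := by
  have h1 := hP1.deg_lam_le hw₀ hP4 x y
  have h2 : deg (barA (lam L w₀ x y)) ≤ ((-shift L w₀ y : Γ) : WithBot Γ) := by
    rw [barA_lam hw₀, deg_sgn_mul, deg_sgn_mul, deg_sgn_mul]
    convert hP1.deg_lam_le hw₀ hP4 (w₀ * y) (w₀ * x) using 2
    rw [← hP4.shift_eq_of_leftEquiv hw₀ hxy, shift, shift, longest_mul_cancel hw₀, neg_sub]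
  rw [deg_le_iff] at h1 h2
  ext γ
  rw [AddMonoidAlgebra.coeff_single, Finsupp.single_apply]
  split_ifs with h
  · rw [lead, h]
  · by_contra h0
    refine h (le_antisymm ?_ (h1 γ h0))
    exact neg_le_neg_iff.1 (h2 (-γ) (by rwa [barA_coeff, neg_neg]))

theorem sum_lam_mul_barA_lam (x : W) :
    ∑ z, lam L w₀ z x * barA (lam L w₀ x z) = 1 := by
  have e : T L w₀ * (bar L (T L w₀) * C L x) = C L x := by
    rw [← mul_assoc, T_longest_mul_bar hw₀, one_mul]
  rw [bar_T_mul_C, Finset.mul_sum] at e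
  have := congrArg (fun h => (C L).repr h x) e
  simpa [map_sum, Finsupp.finsetSum_apply, C_repr_T_longest_mul_C hw₀] using this

/-- A nonzero term in the diagonal entry of `T_{w₀} T_{w₀}⁻¹` needs `z ≤_L x` and `x ≤_L z`. Both
factors are then monomials, with opposite exponents. -/
theorem P1.sum_lead_mul_lead (hP1 : P1 L) (hP4 : P4 L) (x : W) :
    ∑ z, lead L w₀ z x * lead L w₀ x z = 1 := by
  have h := congrArg (fun p => p.coeff 0) (sum_lam_mul_barA_lam (L := L) hw₀ x)
  simp only [AddMonoidAlgebra.coeff_sum, Finsupp.finsetSum_apply] at h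
  rw [AddMonoidAlgebra.one_def, AddMonoidAlgebra.coeff_single, Finsupp.single_eq_same] at h
  rw [← h]
  refine Finset.sum_congr rfl fun z _ => ?_
  by_cases hz : lam L w₀ z x = 0
  · simp [lead, hz]
  by_cases hz' : lam L w₀ x z = 0
  · simp [lead, hz']
  have hzx : LeftEquiv L z x := ⟨leftLE_of_lam_ne_zero hz, leftLE_of_lam_ne_zero hz'⟩
  rw [hP1.lam_eq_single hw₀ hP4 hzx, hP1.lam_eq_single hw₀ hP4 hzx.symm, barA_single,
    AddMonoidAlgebra.single_mul_single, hP4.shift_eq_of_leftEquiv hw₀ hzx, add_neg_cancel,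
    AddMonoidAlgebra.coeff_single, Finsupp.single_eq_same]

theorem C_inv_mul_bar_T (x : W) :
    C L x⁻¹ * bar L (T L w₀) = ∑ z, lam L w₀ z x • C L z⁻¹ := by
  have h : flat L (bar L (T L w₀) * C L x) = C L x⁻¹ * bar L (T L w₀) := by
    rw [flat_mul, flat_C, flat_bar, flat_T_longest hw₀]
  rw [← h, bar_T_mul_C, map_sum]
  simp only [map_smul, flat_C]

/-- In `τ(C_{x⁻¹} T_{w₀}⁻² C_x)`, letting one `T_{w₀}⁻¹` act on each side gives the sum of squares
in top degree, while letting both act on `C_x` gives the sum in `P1.sum_lead_mul_lead`. -/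
theorem P8.sum_lead_sq (hP1 : P1 L) (hP4 : P4 L) (hP8 : P8 L) (x : W) :
    ∑ z, lead L w₀ z x * lead L w₀ z x = 1 := by
  classical
  have e1 : tau L (C L x⁻¹ * bar L (T L w₀) * (bar L (T L w₀) * C L x)) =
      ∑ z, ∑ y, lam L w₀ z x * lam L w₀ y x * tau L (C L z⁻¹ * C L y) := by
    rw [C_inv_mul_bar_T hw₀, bar_T_mul_C, Finset.sum_mul_sum, map_sum]
    simp only [map_sum, smul_mul_smul_comm, map_smul, smul_eq_mul]
  have e2 : tau L (C L x⁻¹ * bar L (T L w₀) * (bar L (T L w₀) * C L x)) =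
      ∑ z, ∑ y, lam L w₀ z x * lam L w₀ y z * tau L (C L x⁻¹ * C L y) := by
    rw [bar_T_mul_C, Finset.mul_sum, map_sum]
    refine Finset.sum_congr rfl fun z _ => ?_
    rw [mul_smul_comm, map_smul, mul_assoc, bar_T_mul_C, Finset.mul_sum, map_sum, smul_eq_mul,
      Finset.mul_sum]
    simp only [mul_smul_comm, map_smul, smul_eq_mul, mul_assoc]
  rw [e1] at e2
  -- The final `0` is the degree bound for `τ(C_{z⁻¹} C_y)`; the exponent is kept as a sum to match
  -- `coeff_mul_of_deg_le`.
  have h := congrArg (fun p => p.coeff (shift L w₀ x + shift L w₀ x + 0)) e2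
  simp only [AddMonoidAlgebra.coeff_sum, Finsupp.finsetSum_apply] at h
  have hd := hP1.deg_lam_le hw₀ hP4
  rw [← hP1.sum_lead_mul_lead hw₀ hP4 x]
  convert h using 1
  · refine Finset.sum_congr rfl fun z _ => ?_
    rw [Finset.sum_eq_single z]
    · rw [coeff_mul_of_deg_le (deg_mul_le (hd z x) (hd z x)) (deg_tau_C_inv_mul_C_le z z),
        coeff_mul_of_deg_le (hd z x) (hd z x), coeff_tau_C_inv_mul_C, if_pos rfl, mul_one]
      rfl
    · intro y _ hy
      rw [coeff_mul_of_deg_le (deg_mul_le (hd z x) (hd y x)) (deg_tau_C_inv_mul_C_le z y),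
        coeff_tau_C_inv_mul_C, if_neg hy.symm, mul_zero]
    · simp
  · refine Finset.sum_congr rfl fun z _ => ?_
    by_cases hz : lam L w₀ z x = 0
    · simp [lead, hz]
    have hd' : ∀ y, deg (lam L w₀ y z) ≤ ((shift L w₀ x : Γ) : WithBot Γ) := fun y =>
      (hd y z).trans (WithBot.coe_le_coe.2
        (hP4.shift_le_of_leftLE hw₀ (leftLE_of_lam_ne_zero hz)))
    rw [Finset.sum_eq_single x]
    · rw [coeff_mul_of_deg_le (deg_mul_le (hd z x) (hd' x)) (deg_tau_C_inv_mul_C_le x x),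
        coeff_mul_of_deg_le (hd z x) (hd' x), coeff_tau_C_inv_mul_C, if_pos rfl, mul_one]
      -- The coefficient of `λ_{x,z}` is taken at the shift of `x`, whereas `lead` uses that of `z`.
      -- They agree when the first factor is nonzero, for then `z ∼_L x`.
      by_cases hl : lead L w₀ z x = 0
      · rw [hl, zero_mul]; rw [lead] at hl; rw [hl, zero_mul]
      · rw [lead, lead, hP4.shift_eq_of_leftEquiv hw₀ (hP8.leftEquiv_of_lead_ne_zero hw₀ hP1 hP4 hl)]
    · intro y _ hy
      rw [coeff_mul_of_deg_le (deg_mul_le (hd z x) (hd' y)) (deg_tau_C_inv_mul_C_le x y),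
        coeff_tau_C_inv_mul_C, if_neg hy.symm, mul_zero]
    · simp

omit hw₀ [Group W] in
theorem exists_unique_ne_zero_of_sum_sq {f : W → ℤ} (hf : ∑ z, f z * f z = 1) :
    ∃ x, f x ≠ 0 ∧ ∀ z, f z ≠ 0 → z = x := by
  classical
  obtain ⟨x, -, hx⟩ := Finset.exists_ne_zero_of_sum_ne_zero (hf.trans_ne one_ne_zero)
  have hx := left_ne_zero_of_mul hx
  refine ⟨x, hx, fun z hz => ?_⟩
  by_contra hzx
  have h1 : ∑ y ∈ {x, z}, f y * f y ≤ ∑ y, f y * f y :=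
    Finset.sum_le_sum_of_subset_of_nonneg (Finset.subset_univ _) fun y _ _ => mul_self_nonneg _
  rw [Finset.sum_pair (Ne.symm hzx), hf] at h1
  have h2 := mul_self_pos.2 hx
  have h3 := mul_self_pos.2 hz
  omega

/-- Modulo terms of lower degree, `T_{w₀}⁻¹` permutes the Kazhdan–Lusztig basis elements up to
signs and powers of `v`, by an involution preserving the left cells. -/
theorem P8.exists_involution (hP1 : P1 L) (hP4 : P4 L) (hP8 : P8 L) : ∃ σ : W → W,
    (∀ x, LeftEquiv L (σ x) x) ∧ (∀ x, σ (σ x) = x) ∧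
      ∀ x z, lead L w₀ z x ≠ 0 ↔ z = σ x := by
  choose σ h1 h2 using fun x => exists_unique_ne_zero_of_sum_sq (hP8.sum_lead_sq hw₀ hP1 hP4 x)
  refine ⟨σ, fun x => hP8.leftEquiv_of_lead_ne_zero hw₀ hP1 hP4 (h1 x), fun x => ?_,
    fun x z => ⟨h2 x z, fun h => h ▸ h1 x⟩⟩
  -- Some product `n_{z,x} n_{x,z}` is nonzero; the first factor forces `z = σ(x)`, the second `x =
  -- σ(z)`.
  have h3 := hP1.sum_lead_mul_lead hw₀ hP4 x
  obtain ⟨z, -, hz⟩ := Finset.exists_ne_zero_of_sum_ne_zero (h3.trans_ne one_ne_zero)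
  have e := h2 x z (left_ne_zero_of_mul hz)
  subst e
  exact (h2 _ _ (right_ne_zero_of_mul hz)).symm

omit hw₀ in
-- P₁₃ gives `γ_{d⁻¹,d,d} ≠ 0`, so `d ∼_L d⁻¹` by P₈. Both lie in `𝒟`, and a left cell has only one
-- such element.
theorem P13.inv_eq_of_mem_D (hP8 : P8 L) (hP13 : P13 L) {d : W} (hd : d ∈ D L) : d⁻¹ = d := by
  have h1 := (hP13 d).2 d (LeftEquiv.refl d) hd d (LeftEquiv.refl d)
  have h2 := (hP8 _ _ _ h1).2.1
  exact (hP13 d).1.unique ⟨h2.symm, (inv_mem_D L).2 hd⟩ ⟨LeftEquiv.refl d, hd⟩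

theorem longest_mul_mem_D_iff {w : W} :
    w₀ * w ∈ D L ↔ w₀ * w⁻¹ ∈ D L := by
  have h0 : w₀ * (w₀ * w⁻¹) * w₀ = (w₀ * w)⁻¹ := by
    rw [longest_mul_cancel hw₀, mul_inv_rev, CoxeterSystem.longest_inv hw₀]
  rw [← longest_conj_mem_D hw₀ (z := w₀ * w⁻¹), h0, inv_mem_D]

/-- With `w₀w ∈ 𝒟`, P₂ leaves only `z = (w₀d)⁻¹` in `P1.lead_eq_sum`. Its trace factor is nonzero
because `w₀z = w₀dw₀` has the same trace as `d ∈ 𝒟`, and its `γ` factor by P₁₃. -/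
theorem P13.lead_ne_zero (hP1 : P1 L) (hP2 : P2 L) (hP4 : P4 L) (hP8 : P8 L) (hP13 : P13 L)
    {w d : W} (hw : w₀ * w ∈ D L) (hd : d ∈ D L) (hdw : LeftEquiv L d w) :
    lead L w₀ d w ≠ 0 := by
  have hinv := P13.inv_eq_of_mem_D hP8 hP13 hw
  have hdinv := P13.inv_eq_of_mem_D hP8 hP13 hd
  rw [hP1.lead_eq_sum hw₀ hP4, hinv, Finset.sum_eq_single (w₀ * d)⁻¹]
  · have h1 : w₀ * (w₀ * d)⁻¹ = w₀ * d * w₀ := by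
      rw [mul_inv_rev, CoxeterSystem.longest_inv hw₀, hdinv, mul_assoc]
    have h2 : (tau L (C L (w₀ * (w₀ * d)⁻¹))).coeff (-a L w) ≠ 0 := by
      rw [h1, tau_longest_conj hw₀, ← hP4.a_eq_of_leftEquiv hdw]
      exact (hP1.mem_D_iff d).1 hd
    have h3 := (hP13 (w₀ * w)).2 (w₀ * w) (LeftEquiv.refl _) hw (w₀ * d)
      (LeftEquiv.longest_mul hw₀ hdw)
    have h4 : ∀ k : ℕ, (-1 : ℤ) ^ k ≠ 0 := fun k => pow_ne_zero _ (by norm_num)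
    exact mul_ne_zero (h4 _) (mul_ne_zero (h4 _) (mul_ne_zero (h4 _) (mul_ne_zero h2 h3)))
  · intro z _ hz
    by_contra h0
    exact hz (hP2 _ hw _ _ (right_ne_zero_of_mul (right_ne_zero_of_mul h0)))
  · simp

theorem P13.involution_mem_D_iff (hP1 : P1 L) (hP2 : P2 L) (hP4 : P4 L) (hP8 : P8 L)
    (hP13 : P13 L) {σ : W → W} (hσ : ∀ x, LeftEquiv L (σ x) x) (hσσ : ∀ x, σ (σ x) = x)
    (hlead : ∀ x z, lead L w₀ z x ≠ 0 ↔ z = σ x) (w : W) : σ w ∈ D L ↔ w₀ * w⁻¹ ∈ D L := by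
  rw [← longest_mul_mem_D_iff hw₀]
  constructor
  · intro h
    obtain ⟨d', ⟨hd', hd'D⟩, -⟩ := (hP13 (w₀ * w)).1
    have h1 : LeftEquiv L (w₀ * d') w := by
      have := LeftEquiv.longest_mul hw₀ hd'
      rwa [longest_mul_cancel hw₀] at this
    -- For `d'` the element of `𝒟` in the left cell of `w₀w`, this says `σ(w₀d') = σ(w)`;
    -- injectivity of `σ` then gives `w₀w = d'`.
    have h2 := P13.lead_ne_zero hw₀ hP1 hP2 hP4 hP8 hP13 (w := w₀ * d')
      (by rwa [longest_mul_cancel hw₀]) h ((hσ w).trans h1.symm)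
    have h3 : w₀ * d' = w := by
      rw [← hσσ w, (hlead _ _).1 h2, hσσ]
    rwa [← h3, longest_mul_cancel hw₀]
  · intro h
    obtain ⟨d, ⟨hd, hdD⟩, -⟩ := (hP13 w).1
    rwa [← (hlead _ _).1 (P13.lead_ne_zero hw₀ hP1 hP2 hP4 hP8 hP13 h hdD hd)]

theorem P1.tau_pow_mul_C (hP1 : P1 L) (hP4 : P4 L) {σ : W → W} (hσ : ∀ x, LeftEquiv L (σ x) x)
    (hlead : ∀ x z, lead L w₀ z x ≠ 0 ↔ z = σ x) (n : ℕ) (w : W) :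
    deg (tau L (bar L (T L w₀) ^ n * C L w)) ≤
        ((-a L w + n • shift L w₀ w : Γ) : WithBot Γ) ∧
      ((tau L (bar L (T L w₀) ^ n * C L w)).coeff (-a L w + n • shift L w₀ w) ≠ 0 ↔
        σ^[n] w ∈ D L) := by
  induction n generalizing w with
  | zero => simpa using ⟨hP1.deg_tau_C_le w, (hP1.mem_D_iff w).symm⟩
  | succ n ih =>
    have e : tau L (bar L (T L w₀) ^ (n + 1) * C L w) =
        ∑ z, lam L w₀ z w * tau L (bar L (T L w₀) ^ n * C L z) := by
      rw [pow_succ, mul_assoc, bar_T_mul_C, Finset.mul_sum, map_sum]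
      simp only [mul_smul_comm, map_smul, smul_eq_mul]
    have hexp : -a L w + (n + 1) • shift L w₀ w =
        shift L w₀ w + (-a L w + n • shift L w₀ w) := by
      rw [succ_nsmul]; abel
    -- Only `z ≤_L w` occur, and both `-a` and the shift are monotone for `≤_L`, so the bound for
    -- `z` is dominated by that for `w`.
    have hd : ∀ z, lam L w₀ z w ≠ 0 → deg (tau L (bar L (T L w₀) ^ n * C L z)) ≤
        ((-a L w + n • shift L w₀ w : Γ) : WithBot Γ) := by
      intro z hz
      have hzw := leftLE_of_lam_ne_zero hz
      refine (ih z).1.trans (WithBot.coe_le_coe.2 ?_)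
      exact add_le_add (neg_le_neg (hP4 _ _ hzw.twoSidedLE))
        (nsmul_le_nsmul_right (hP4.shift_le_of_leftLE hw₀ hzw) n)
    rw [e, hexp]
    refine ⟨deg_sum_le fun z _ => ?_, ?_⟩
    · by_cases hz : lam L w₀ z w = 0
      · rw [hz, zero_mul, deg_zero]; exact bot_le
      · exact deg_mul_le (hP1.deg_lam_le hw₀ hP4 z w) (hd z hz)
    · have hne := (hlead w (σ w)).2 rfl
      have hne' : lam L w₀ (σ w) w ≠ 0 := fun h0 => hne (by simp [lead, h0])
      -- Only `z = σ(w)` reaches the top degree. It shares `a` and the shift with `w`, so the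
      -- induction hypothesis for it concerns exactly the exponent needed.
      rw [AddMonoidAlgebra.coeff_sum, Finsupp.finsetSum_apply, Finset.sum_eq_single (σ w),
        coeff_mul_of_deg_le (hP1.deg_lam_le hw₀ hP4 _ w) (hd _ hne'),
        mul_ne_zero_iff, ← lead, and_iff_right hne, ← hP4.a_eq_of_leftEquiv (hσ w),
        ← hP4.shift_eq_of_leftEquiv hw₀ (hσ w), (ih (σ w)).2, Function.iterate_succ_apply]
      · intro z _ hz
        by_cases h0 : lam L w₀ z w = 0
        · simp [h0]
        · rw [coeff_mul_of_deg_le (hP1.deg_lam_le hw₀ hP4 _ w) (hd z h0)]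
          have : lead L w₀ z w = 0 := by
            by_contra h1; exact hz ((hlead _ _).1 h1)
          rw [lead] at this
          rw [this, zero_mul]
      · simp

end

end Hecke

theorem corollary1p3 {B : Type*} {M : CoxeterMatrix B} {W : Type*} [Group W] [Fintype W]
    (cs : CoxeterSystem M W)
    {Γ : Type*} [AddCommGroup Γ] [LinearOrder Γ] [IsOrderedAddMonoid Γ]
    (L : Hecke.WeightFunction cs Γ)
    (w₀ : W) (hw₀ : ∀ x : W, cs.length x ≤ cs.length w₀)
    (hP1 : Hecke.P1 L) (hP2 : Hecke.P2 L) (hP4 : Hecke.P4 L) (hP8 : Hecke.P8 L)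
    (hP9 : Hecke.P9 L) (hP13 : Hecke.P13 L) (w : W) (n : ℕ) :
    Hecke.deg (Hecke.tau L
        (((Hecke.TUnit L w₀ ^ (-(n : ℤ)) : (Hecke.HeckeAlgebra L)ˣ) : Hecke.HeckeAlgebra L) *
          Hecke.C L w)) ≤
      ((-Hecke.a L w + n • (Hecke.a L (w₀ * w) - Hecke.a L w) : Γ) : WithBot Γ) ∧
    (Hecke.deg (Hecke.tau L
        (((Hecke.TUnit L w₀ ^ (-(n : ℤ)) : (Hecke.HeckeAlgebra L)ˣ) : Hecke.HeckeAlgebra L) *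
          Hecke.C L w)) =
      ((-Hecke.a L w + n • (Hecke.a L (w₀ * w) - Hecke.a L w) : Γ) : WithBot Γ) ↔
      w₀ ^ n * w⁻¹ ∈ Hecke.D L) := by
  have hunit : (((Hecke.TUnit L w₀ ^ (-(n : ℤ)) : (Hecke.HeckeAlgebra L)ˣ) :
      Hecke.HeckeAlgebra L)) = Hecke.bar L (Hecke.T L w₀) ^ n := by
    rw [zpow_neg, zpow_natCast, ← inv_pow, Units.val_pow_eq_pow_val, Hecke.bar_T,
      CoxeterSystem.longest_inv hw₀]
  obtain ⟨σ, hσ, hσσ, hlead⟩ := hP8.exists_involution hw₀ hP1 hP4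
  obtain ⟨h1, h2⟩ := hP1.tau_pow_mul_C hw₀ hP4 hσ hlead n w
  rw [hunit]
  refine ⟨h1, (Hecke.deg_eq_iff h1).trans (h2.trans ?_)⟩
  have hσ2 : σ^[2] = id := funext hσσ
  have hw2 : w₀ ^ 2 = 1 := by rw [pow_two, CoxeterSystem.longest_mul_self hw₀]
  -- Both `σ` and `w₀` square to the identity, so only the parity of `n` matters.
  rcases Nat.even_or_odd' n with ⟨k, rfl | rfl⟩
  · rw [Function.iterate_mul, hσ2, Function.iterate_id, id, pow_mul, hw2, one_pow, one_mul,
      Hecke.inv_mem_D]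
  · rw [Function.iterate_succ_apply, Function.iterate_mul, hσ2, Function.iterate_id, id, pow_succ,
      pow_mul, hw2, one_pow, one_mul]
    exact hP13.involution_mem_D_iff hw₀ hP1 hP2 hP4 hP8 hσ hσσ hlead w
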